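/- Let $n\ge 0$ be an integer and let $K$ be a commutative ring (for instance $K=\mathbb Z$ or $K=\mathbb Q$). **Pure braid chord diagrams.** A pure braid chord diagram on $n$ parallel directed strands is a finite sequence of horizontal chords $t^{ij}=t^{ji}$ ($1\le i\ne j\le n$), the chord $t^{ij}$ joining strands $i$ and $j$. Let $\mathcal D^{pb}$ be the free $K$-module on these diagrams, with the product given by stacking; it is the free associative $K$-algebra on the $t^{ij}$. Let $\mathcal A^{pb}$ be the quotient of $\mathcal D^{pb}$ by the two-sided ideal generated by the relations $$t^{ij}t^{kl}=t^{kl}t^{ij}\quad(|\{i,j,k,l\}|=4),\qquad [t^{ik}+t^{jk},\,t^{ij}]=0\quad(|\{i,j,k\}|=3).$$ **String link diagrams.** A string link diagram on $n$ directed strands is a finite graph (multiple edges and loops allowed) whose vertices are univalent vertices lying at distinct points of the strands, and internal trivalent vertices each equipped with an orientation (a cyclic order of its three incident half-edges), such that every connected component of the graph has a vertex on some strand. Diagrams are considered up to isomorphism, that is, up to isomorphisms of graphs which preserve the orientations of the internal vertices, the strand on which each univalent vertex lies, and the order of the univalent vertices along each strand. Let $\mathcal A^{sl}$ be the free $K$-module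 on (isomorphism classes of) string link diagrams, modulo all STU relations $S=T-U$. Here $S$ has an edge joining a point $x$ of a strand to an internal vertex whose half-edges are, in cyclic order, $v,a,b$ with $v$ on that edge; $T$ and $U$ are obtained from $S$ by deleting this edge and letting $a$ and $b$ end at two adjacent points of the strand in place of $x$, in the order $b,a$ along the strand in $T$ and in the order $a,b$ in $U$. **Statement.** Regarding a pure braid chord diagram as a string link diagram without internal vertices gives a well-defined $K$-linear map $\mathcal A^{pb}\to\mathcal A^{sl}$, and this map is injective. -/

import Mathlib

namespace ChordDiagrams

/-! ### Pure braid chord diagrams -/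

/-- A horizontal chord joining two different strands among `n` strands. -/
abbrev Chord (n : ℕ) : Type := {c : Sym2 (Fin n) // ¬ c.IsDiag}

/-- The chord joining the strands `i ≠ j`; it does not depend on the order of `i` and `j`. -/
def chord {n : ℕ} (i j : Fin n) (h : i ≠ j) : Chord n :=
  ⟨s(i, j), fun hd => h (Sym2.mk_isDiag_iff.1 hd)⟩

/-- A chord diagram of `n`-strand pure braids: its chords, listed in the order in which they
are met when one travels along the strands in their common direction. -/
abbrev PbDiagram (n : ℕ) : Type := List (Chord n)

/-- The algebra freely spanned by all pure braid chord diagrams, with stacking as the product: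
the free associative algebra on the diagrams with a single chord. -/
abbrev Dpb (K : Type*) [CommRing K] (n : ℕ) : Type _ := FreeAlgebra K (Chord n)

/-- The degree one chord diagram `t^{ij}`. -/
def t (K : Type*) [CommRing K] {n : ℕ} (i j : Fin n) (h : i ≠ j) : Dpb K n :=
  FreeAlgebra.ι K (chord i j h)

/-- The relations imposed on pure braid chord diagrams: chords without a common strand commute,
and `[t^{ik} + t^{jk}, t^{ij}] = 0` for different `i, j, k`. -/
inductive PbRel (K : Type*) [CommRing K] (n : ℕ) : Dpb K n → Dpb K n → Prop
  | comm (i j k l : Fin n) (hij : i ≠ j) (hkl : k ≠ l)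
      (hik : i ≠ k) (hil : i ≠ l) (hjk : j ≠ k) (hjl : j ≠ l) :
      PbRel K n (t K i j hij * t K k l hkl) (t K k l hkl * t K i j hij)
  | fourT (i j k : Fin n) (hij : i ≠ j) (hik : i ≠ k) (hjk : j ≠ k) :
      PbRel K n ((t K i k hik + t K j k hjk) * t K i j hij)
        (t K i j hij * (t K i k hik + t K j k hjk))

/-- The algebra `A^{pb}`: the quotient by the two-sided ideal generated by the relations. -/
abbrev Apb (K : Type*) [CommRing K] (n : ℕ) : Type _ := RingQuot (PbRel K n)

/-- The class in `A^{pb}` of a pure braid chord diagram. -/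
noncomputable def Apb.mk (K : Type*) [CommRing K] {n : ℕ} (w : PbDiagram n) : Apb K n :=
  RingQuot.mkAlgHom K (PbRel K n) (w.map (FreeAlgebra.ι K)).prod

/-! ### String link diagrams -/

/-- A string link diagram on `n` directed strands: a graph whose vertices are univalent vertices
lying on the strands and oriented (that is, with a cyclic order of the incident half-edges)
internal trivalent vertices. It is described by its half-edges. -/
structure SlDiagram (n : ℕ) where
  /-- The half-edges of the graph. -/
  H : Type
  finite : Finite H
  /-- The other half of the edge containing a given half-edge. -/
  edge : H → H
  edge_edge : ∀ h, edge (edge h) = h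
  edge_ne : ∀ h, edge h ≠ h
  /-- The next half-edge in the cyclic order around the vertex of a given half-edge.
  The orbits with three elements are the internal vertices. -/
  rot : H → H
  rot_rot_rot : ∀ h, rot (rot (rot h)) = h
  /-- The half-edges that end on a given strand, listed along the direction of the strand. -/
  legs : Fin n → List H
  nodup : ∀ i, (legs i).Nodup
  disjoint : ∀ i j, i ≠ j → (legs i).Disjoint (legs j)
  rot_eq_iff : ∀ h, rot h = h ↔ ∃ i, h ∈ legs i
  /-- Every connected component of the graph touches a strand. -/
  connected : ∀ h, ∃ i, ∃ x ∈ legs i,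
    Relation.ReflTransGen (fun a b => b = edge a ∨ b = rot a) x h

namespace SlDiagram

variable {n : ℕ}

/-- Two string link diagrams are isomorphic: there is a bijection of the half-edges
respecting the edges, the oriented vertices, and the strands. -/
def Iso (D D' : SlDiagram n) : Prop :=
  ∃ e : D.H ≃ D'.H, (∀ h, e (D.edge h) = D'.edge (e h)) ∧ (∀ h, e (D.rot h) = D'.rot (e h)) ∧
    ∀ i, (D.legs i).map e = D'.legs i

/-- `T` is obtained from `S` as follows: the half-edges `x` and `v` are removed, the list of
legs on the strand `i` becomes `L`, and all else (the remaining edges, the legs on the other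
strands, and the internal vertices made up of half-edges that are not legs of `T`) is kept. -/
def IsResolution (S T : SlDiagram n) (x v : S.H) (i : Fin n) (L : List S.H) : Prop :=
  ∃ f : T.H → S.H, Function.Injective f ∧ Set.range f = {h | h ≠ x ∧ h ≠ v} ∧
    (∀ h, f (T.edge h) = S.edge (f h)) ∧
    (∀ h, T.rot h ≠ h → f (T.rot h) = S.rot (f h)) ∧
    (T.legs i).map f = L ∧ ∀ j, j ≠ i → (T.legs j).map f = S.legs j

/-- `S`, `T`, `U` are the three diagrams of an `STU` relation `S = T - U`. In `S`, an edge
`{x, v}` joins a point `x` of the strand `i` to an internal vertex with the cyclically ordered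
half-edges `v, rot v, rot (rot v)`. In `T` and `U` this edge is removed and the two other
half-edges at the vertex end at adjacent points of the strand, replacing `x`: in the order
`rot (rot v), rot v` in `T`, and in the order `rot v, rot (rot v)` in `U`. -/
def IsSTU (S T U : SlDiagram n) : Prop :=
  ∃ (i : Fin n) (x v : S.H) (l₁ l₂ : List S.H),
    S.edge x = v ∧ S.rot v ≠ v ∧ S.legs i = l₁ ++ [x] ++ l₂ ∧
    IsResolution S T x v i (l₁ ++ [S.rot (S.rot v), S.rot v] ++ l₂) ∧
    IsResolution S U x v i (l₁ ++ [S.rot v, S.rot (S.rot v)] ++ l₂)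

/-- String link diagrams up to isomorphism. -/
abbrev Class (n : ℕ) : Type 1 := Quot (Iso (n := n))

end SlDiagram

/-- The submodule spanned by the `STU` relations. -/
noncomputable def stuSubmodule (K : Type*) [CommRing K] (n : ℕ) :
    Submodule K (SlDiagram.Class n →₀ K) :=
  Submodule.span K {r | ∃ S T U : SlDiagram n, S.IsSTU T U ∧
    r = Finsupp.single (Quot.mk _ S) 1 -
      (Finsupp.single (Quot.mk _ T) 1 - Finsupp.single (Quot.mk _ U) 1)}

/-- The space `A^{sl}`: the free module on the isomorphism classes of string link diagrams,
modulo `STU`. -/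
abbrev Asl (K : Type*) [CommRing K] (n : ℕ) : Type _ :=
  (SlDiagram.Class n →₀ K) ⧸ stuSubmodule K n

/-- The class in `A^{sl}` of a string link diagram. -/
noncomputable def Asl.mk (K : Type*) [CommRing K] {n : ℕ} (D : SlDiagram n) : Asl K n :=
  (stuSubmodule K n).mkQ (Finsupp.single (Quot.mk _ D) 1)

/-! ### Pure braid chord diagrams as string link diagrams -/

namespace PbDiagram

variable {n : ℕ}

/-- The ends of the chords of `w`: the pair `(k, i)` is the end of chord number `k` on the
strand `i`. -/
abbrev Ends (w : PbDiagram n) : Type :=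
  {p : Fin w.length × Fin n // p.2 ∈ (w.get p.1).1}

/-- The other end of the same chord. -/
noncomputable def otherEnd (w : PbDiagram n) (p : Ends w) : Ends w :=
  ⟨(p.1.1, Sym2.Mem.other p.2), Sym2.other_mem p.2⟩

/-- The chord ends on the strand `i`, in order. -/
def endsOn (w : PbDiagram n) (i : Fin n) : List (Ends w) :=
  (List.finRange w.length).filterMap fun k =>
    if h : i ∈ (w.get k).1 then some ⟨(k, i), h⟩ else none

theorem mem_endsOn (w : PbDiagram n) (i : Fin n) (p : Ends w) :
    p ∈ endsOn w i ↔ p.1.2 = i := by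
  obtain ⟨⟨k, j⟩, hp⟩ := p
  simp only [endsOn, List.mem_filterMap, List.mem_finRange, true_and]
  constructor
  · rintro ⟨a, ha⟩
    split_ifs at ha with h
    simp only [Option.some.injEq, Subtype.mk.injEq, Prod.mk.injEq] at ha
    exact ha.2.symm
  · rintro rfl
    exact ⟨k, dif_pos hp⟩

theorem nodup_endsOn (w : PbDiagram n) (i : Fin n) : (endsOn w i).Nodup := by
  refine List.Nodup.filterMap ?_ (List.nodup_finRange _)
  intro a b p ha hb
  simp only [Option.mem_def] at ha hb
  split_ifs at ha hb
  simp only [Option.some.injEq] at ha hb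
  have := ha.trans hb.symm
  simp only [Subtype.mk.injEq, Prod.mk.injEq] at this
  exact this.1

/-- A pure braid chord diagram, seen as a string link diagram without internal vertices. -/
noncomputable def toSl (w : PbDiagram n) : SlDiagram n where
  H := Ends w
  finite := inferInstance
  edge := otherEnd w
  edge_edge p := by
    obtain ⟨⟨k, j⟩, hp⟩ := p
    exact Subtype.ext (Prod.ext rfl (Sym2.other_invol hp _))
  edge_ne p hp := Sym2.other_ne (w.get p.1.1).2 p.2 (congrArg (fun q => q.1.2) hp)
  rot p := p
  rot_rot_rot _ := rfl
  legs := endsOn w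
  nodup := nodup_endsOn w
  disjoint i j hij p hi hj :=
    hij (((mem_endsOn w i p).1 hi).symm.trans ((mem_endsOn w j p).1 hj))
  rot_eq_iff p := ⟨fun _ => ⟨p.1.2, (mem_endsOn w _ p).2 rfl⟩, fun _ => rfl⟩
  connected p := ⟨p.1.2, p, (mem_endsOn w _ p).2 rfl, Relation.ReflTransGen.refl⟩

end PbDiagram

end ChordDiagrams

/-!
The map exists because the relations of `A^{pb}` hold in `A^{sl}`: chords without a common strand
can be interchanged up to isomorphism (`mk_toSl_comm`), and the four-term relation
(`mk_toSl_fourT`) compares the `STU` relations at two legs of one diagram with a single internal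
vertex (`mk_triDiagram`).

Injectivity is shown by state sums (`WeightData`). A finite Lie algebra basis with an invariant
pairing, together with commuting representations of the Lie algebra on the strands, assigns an
operator to every string link diagram: sum over all colourings of the half-edges by basis elements,
and multiply structure constants at the internal vertices and operators at the legs. The `STU`
relation holds because the representations respect the bracket (`WeightData.weight_stu`), and a
chord diagram is sent to the product of the Casimir operators of its chords
(`WeightData.weight_toSl`).

The Lie algebra used here is that of square matrices, extended by its dual space as an abelian
ideal (`matWeight`). It acts on polynomials in the entries of a matrix `X_i` and a vector `Y_i` for
each strand `i`: matrices act by derivations, the dual space by multiplication with entries of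
`X_i`. The chord `t^{ij}` then acts as the derivation with `X_i ↦ [X_j, X_i]`, `X_j ↦ [X_i, X_j]`,
`Y_i ↦ X_j Y_i`, `Y_j ↦ X_i Y_j` (`chordDer_matMul`, `chordDer_vecVar`), an infinitesimal version of
the action of pure braids on a free group. This is applied to products of entries of vectors
`X_{l₁} X_{l₂} ⋯ Y_m`, one for each strand `m`. For `i < j`, the chord `t^{ij}` appends `i` to the
word of `j`; all other terms are negligible in a triangular sense, as they either contain a letter
`≥ m` in the word of some strand `m`, or lengthen the word of a strand beyond `j`
(`chordDer_wordProd_sub_mem`).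

By the relations, `A^{pb}` is spanned by the chord diagrams in which the last strands of the chords
increase weakly (`mem_span_sorted`). Such a diagram is determined by the words of the other strands
of its chords (`partners_injOn`). Evaluating at suitable matrices and vectors with entries `0` and
`1` (`evalAt_wordProd`) gives a functional on `A^{sl}` that is `1` on a given sorted diagram and `0`
on all other sorted diagrams of the same or larger height (`exists_functional`). All coefficients
are `0` or `1`, so that this works over every commutative ring.
-/

namespace ChordDiagrams

noncomputable section

/-! ### Transversals of the internal vertices -/

section Transversal

variable {H : Type*} (rot : H → H)

/-- `a` and `b` lie in the same orbit of the map `rot`, whose third power is the identity. -/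
def SameOrbit (a b : H) : Prop := a = b ∨ a = rot b ∨ a = rot (rot b)

/-- `R` contains exactly one element of each orbit contained in `A`, and no others. -/
def IsTransversal (A : Set H) (R : Finset H) : Prop :=
  (∀ r ∈ R, r ∈ A) ∧ ∀ h ∈ A, ∃! r, r ∈ R ∧ SameOrbit rot r h

variable {rot}

theorem sameOrbit_equivalence (hrot : ∀ h, rot (rot (rot h)) = h) :
    Equivalence (SameOrbit rot) where
  refl _ := Or.inl rfl
  symm := by
    rintro a b (rfl | rfl | rfl)
    · exact Or.inl rfl
    · exact Or.inr (Or.inr (hrot b).symm)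
    · exact Or.inr (Or.inl (hrot b).symm)
  trans := by
    rintro a b c (rfl | rfl | rfl) (rfl | rfl | rfl) <;> simp [SameOrbit, hrot]

theorem exists_isTransversal [Finite H] (hrot : ∀ h, rot (rot (rot h)) = h) (A : Set H)
    (hA : ∀ h ∈ A, rot h ∈ A) : ∃ R, IsTransversal rot A R := by
  classical
  cases nonempty_fintype H
  let s : Setoid H := ⟨SameOrbit rot, sameOrbit_equivalence hrot⟩
  refine ⟨Finset.univ.filter fun h => h ∈ A ∧ (Quotient.mk s h).out = h,
    fun r hr => (Finset.mem_filter.1 hr).2.1, fun h hh => ?_⟩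
  have key : SameOrbit rot (Quotient.mk s h).out h := Quotient.mk_out (s := s) h
  refine ⟨(Quotient.mk s h).out, ⟨?_, key⟩, ?_⟩
  · simp only [Finset.mem_filter, Finset.mem_univ, true_and, Quotient.out_eq, and_true]
    rcases key with e | e | e <;> rw [e]
    exacts [hh, hA _ hh, hA _ (hA _ hh)]
  · rintro r ⟨hr, hrh⟩
    simp only [Finset.mem_filter, Finset.mem_univ, true_and] at hr
    have : Quotient.mk s r = Quotient.mk s h := Quotient.sound (s := s) hrh
    rw [← hr.2, this]

theorem IsTransversal.prod_eq {M : Type*} [CommMonoid M] (hrot : ∀ h, rot (rot (rot h)) = h)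
    {A : Set H} {R R' : Finset H} (hR : IsTransversal rot A R) (hR' : IsTransversal rot A R')
    (g : H → M) (hg : ∀ h, g (rot h) = g h) : ∏ r ∈ R, g r = ∏ r ∈ R', g r := by
  have E := sameOrbit_equivalence hrot
  have hgo : ∀ a b, SameOrbit rot a b → g a = g b := by
    rintro a b (rfl | rfl | rfl) <;> simp [hg]
  choose φ hφ _ using fun r (hr : r ∈ R) => hR'.2 r (hR.1 r hr)
  refine Finset.prod_bij φ (fun r hr => (hφ r hr).1) ?_ ?_ ?_
  · intro a ha b hb hab
    refine (hR.2 a (hR.1 a ha)).unique ⟨ha, E.refl a⟩ ⟨hb, ?_⟩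
    exact E.trans (E.symm (hφ b hb).2) (hab ▸ (hφ a ha).2)
  · intro r' hr'
    obtain ⟨r, ⟨hr, hrr⟩, -⟩ := hR.2 r' (hR'.1 r' hr')
    exact ⟨r, hr, (hR'.2 r (hR.1 r hr)).unique (hφ r hr) ⟨hr', E.symm hrr⟩⟩
  · intro r hr
    exact hgo _ _ (E.symm (hφ r hr).2)

end Transversal

namespace SlDiagram

variable {n : ℕ}

instance (D : SlDiagram n) : Finite D.H := D.finite

instance (D : SlDiagram n) : Fintype D.H := Fintype.ofFinite _

/-- The internal half-edges: those which are not legs. -/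
def internal (D : SlDiagram n) : Set D.H := {h | D.rot h ≠ h}

theorem rot_injective (D : SlDiagram n) :
    Function.Injective D.rot := fun a b h => by
  rw [← D.rot_rot_rot a, ← D.rot_rot_rot b, h]

theorem exists_transversal (D : SlDiagram n) :
    ∃ R, IsTransversal D.rot D.internal R :=
  exists_isTransversal D.rot_rot_rot _ fun _ hh e => hh (D.rot_injective e)

end SlDiagram

/-! ### State sums -/

/-- The data of a state sum on string link diagrams: a finite set `C` of colours of half-edges,
thought of as a basis of a Lie algebra with an invariant pairing which pairs each basis element
`a` with exactly one basis element `dual a`; the structure constants `f` of the bracket, with all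
indices lowered by the pairing; and on each strand a representation `ρ i` of the Lie algebra,
such that those on different strands commute. -/
structure WeightData (K : Type*) [CommRing K] (n : ℕ) (C : Type*) [Fintype C]
    (B : Type*) [Ring B] [Algebra K B] where
  dual : C → C
  dual_dual : ∀ a, dual (dual a) = a
  f : C → C → C → K
  cyclic : ∀ a b c, f b c a = f a b c
  ρ : Fin n → C → B
  comm : ∀ i j, i ≠ j → ∀ a b, Commute (ρ i a) (ρ j b)
  stu : ∀ i a b, ρ i b * ρ i a - ρ i a * ρ i b = ∑ c, f c a b • ρ i (dual c)

/-- The product of a family indexed by the strands, in the order of the strands. -/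
def strandProd {n : ℕ} {B : Type*} [Monoid B] (F : Fin n → B) : B :=
  ((List.finRange n).map F).prod

/-- A product over the strands as a function of the factor of a single strand. -/
theorem exists_strandProd_eq {n : ℕ} {B : Type*} [Monoid B] (F : Fin n → B) (i : Fin n) :
    ∃ P Q : B, ∀ G : Fin n → B, (∀ j, j ≠ i → G j = F j) → strandProd G = P * G i * Q := by
  obtain ⟨l, r, h⟩ := List.append_of_mem (List.mem_finRange i)
  have hn := List.nodup_finRange n
  rw [h] at hn
  have hl : ∀ j ∈ l, j ≠ i := by
    rintro j hj rfl
    exact (List.disjoint_of_nodup_append hn) hj (by simp)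
  have hr : ∀ j ∈ r, j ≠ i := by
    rintro j hj rfl
    exact (List.nodup_cons.1 (hn.of_append_right)).1 hj
  refine ⟨(l.map F).prod, (r.map F).prod, fun G hG => ?_⟩
  simp only [strandProd, h, List.map_append, List.map_cons, List.prod_append, List.prod_cons]
  rw [List.map_congr_left fun j hj => hG j (hl j hj),
    List.map_congr_left fun j hj => hG j (hr j hj), mul_assoc]

namespace WeightData

variable {K : Type*} [CommRing K] {n : ℕ} {C : Type*} [Fintype C]
  {B : Type*} [Ring B] [Algebra K B] (X : WeightData K n C B)

/-- The colourings of the half-edges for which the two halves of each edge have dual colours. -/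
abbrev Coloring (D : SlDiagram n) : Type _ :=
  {c : D.H → C // ∀ h, c (D.edge h) = X.dual (c h)}

instance (D : SlDiagram n) : Fintype (X.Coloring D) := by
  classical exact inferInstance

/-- The contribution of a colouring: the product of the structure constants at the vertices
represented in `R`, times the product along each strand of the operators of the legs. -/
def term {H : Type*} (rot : H → H) (R : Finset H) (L : Fin n → List H) (c : H → C) : B :=
  (∏ r ∈ R, X.f (c r) (c (rot r)) (c (rot (rot r)))) •
    strandProd fun i => ((L i).map fun h => X.ρ i (c h)).prod

theorem term_eq_of_transversal (D : SlDiagram n) {R R' : Finset D.H} {A : Set D.H}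
    (hR : IsTransversal D.rot A R) (hR' : IsTransversal D.rot A R') (L : Fin n → List D.H)
    (c : D.H → C) : X.term D.rot R L c = X.term D.rot R' L c := by
  unfold term
  rw [hR.prod_eq D.rot_rot_rot hR' (fun r => X.f (c r) (c (D.rot r)) (c (D.rot (D.rot r))))]
  intro h
  rw [D.rot_rot_rot, X.cyclic]

/-- The state sum of a string link diagram. The choice of representatives of the internal vertices
is irrelevant (`weight_eq`), as `f` is cyclic. -/
def weight (D : SlDiagram n) : B :=
  ∑ c : X.Coloring D, X.term D.rot D.exists_transversal.choose D.legs c.1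

theorem weight_eq (D : SlDiagram n) {R : Finset D.H} (hR : IsTransversal D.rot D.internal R) :
    X.weight D = ∑ c : X.Coloring D, X.term D.rot R D.legs c.1 :=
  Finset.sum_congr rfl fun c _ =>
    X.term_eq_of_transversal D D.exists_transversal.choose_spec hR _ c.1

theorem weight_eq_of_iso {D D' : SlDiagram n} (h : D.Iso D') : X.weight D = X.weight D' := by
  obtain ⟨e, hedge, hrot, hlegs⟩ := h
  obtain ⟨R, hR⟩ := D.exists_transversal
  have hR' : IsTransversal D'.rot D'.internal (R.map e.toEmbedding) := by
    constructor
    · simp only [Finset.mem_map_equiv]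
      intro r hr hr'
      refine hR.1 _ hr (e.injective ?_)
      rw [hrot]; simpa using hr'
    · intro h hh
      have : e.symm h ∈ D.internal := fun hr => hh (by
        have := congrArg e hr
        rwa [hrot, e.apply_symm_apply] at this)
      obtain ⟨r, ⟨hr, ho⟩, hu⟩ := hR.2 _ this
      have hiff : ∀ r, SameOrbit D.rot r (e.symm h) ↔ SameOrbit D'.rot (e r) h := by
        intro r
        simp only [SameOrbit, ← e.injective.eq_iff (a := r), hrot, e.apply_symm_apply]
      refine ⟨e r, ⟨by simpa using hr, (hiff r).1 ho⟩, ?_⟩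
      rintro r' ⟨hr', ho'⟩
      rw [← hu (e.symm r') ⟨by simpa using hr', (hiff _).2 (by simpa using ho')⟩,
        e.apply_symm_apply]
  rw [X.weight_eq D hR, X.weight_eq D' hR']
  symm
  refine Fintype.sum_equiv
    (Equiv.subtypeEquiv (e.symm.arrowCongr (Equiv.refl C)) fun c => ?_) _ _ fun c => ?_
  · simp only [Equiv.arrowCongr_apply, Equiv.coe_refl, Equiv.symm_symm,
      Function.comp_apply, hedge]
    exact ⟨fun h x => h _, fun h x => by simpa [hedge] using h (e.symm x)⟩
  · simp only [term, Equiv.subtypeEquiv_apply, Equiv.arrowCongr_apply, Equiv.coe_refl,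
      Equiv.symm_symm, Function.comp_apply, hrot, Finset.prod_map,
      Equiv.coe_toEmbedding, ← hlegs, List.map_map]
    rfl

end WeightData

/-! ### Invariance of state sums under `STU` -/

namespace SlDiagram

variable {n : ℕ} {S T U : SlDiagram n} {x v : S.H} {i : Fin n} {L : List S.H}

/-- The internal half-edges away from the vertex of `v`. -/
def internalOff (S : SlDiagram n) (v : S.H) : Set S.H :=
  {h | S.rot h ≠ h ∧ ¬ SameOrbit S.rot h v}

/-- A transversal that avoids the vertex of `v` serves for `S`, once `v` is added, as well as for
`T` and `U`. -/
theorem exists_transversal_off (S : SlDiagram n) (v : S.H) :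
    ∃ R, IsTransversal S.rot (S.internalOff v) R := by
  have E := sameOrbit_equivalence S.rot_rot_rot
  refine exists_isTransversal S.rot_rot_rot _ fun h hh =>
    ⟨fun e => hh.1 (S.rot_injective e), fun ho => hh.2 (E.trans ?_ ho)⟩
  exact E.symm (Or.inr (Or.inl rfl))

theorem isTransversal_insert [DecidableEq S.H] (hv : S.rot v ≠ v) {R : Finset S.H}
    (hR : IsTransversal S.rot (S.internalOff v) R) :
    IsTransversal S.rot S.internal (insert v R) := by
  have E := sameOrbit_equivalence S.rot_rot_rot
  constructor
  · intro r hr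
    rcases Finset.mem_insert.1 hr with rfl | hr
    exacts [hv, (hR.1 r hr).1]
  · intro h hh
    by_cases ho : SameOrbit S.rot h v
    · refine ⟨v, ⟨Finset.mem_insert_self _ _, E.symm ho⟩, ?_⟩
      rintro r ⟨hr, hro⟩
      rcases Finset.mem_insert.1 hr with rfl | hr
      exacts [rfl, absurd (E.trans hro ho) (hR.1 r hr).2]
    · obtain ⟨r, ⟨hr, hro⟩, hu⟩ := hR.2 h ⟨hh, ho⟩
      refine ⟨r, ⟨Finset.mem_insert_of_mem hr, hro⟩, ?_⟩
      rintro r' ⟨hr', hro'⟩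
      rcases Finset.mem_insert.1 hr' with rfl | hr'
      exacts [absurd (E.symm hro') ho, hu r' ⟨hr', hro'⟩]

theorem notMem_of_isTransversal_off {R : Finset S.H}
    (hR : IsTransversal S.rot (S.internalOff v) R) : v ∉ R := fun h =>
  (hR.1 v h).2 (Or.inl rfl)

/-- The half-edges of an `STU` diagram `T` that belong to internal vertices. -/
theorem IsResolution.rot_ne_iff {l₁ l₂ M : List S.H} {f : T.H → S.H}
    (hlegs : S.legs i = l₁ ++ [x] ++ l₂) (hf : Function.Injective f)
    (hran : Set.range f = {h | h ≠ x ∧ h ≠ v})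
    (hi : (T.legs i).map f = l₁ ++ M ++ l₂)
    (hM : ∀ h, h ∈ M ↔ h = S.rot v ∨ h = S.rot (S.rot v))
    (hj : ∀ j, j ≠ i → (T.legs j).map f = S.legs j) (t : T.H) :
    T.rot t ≠ t ↔ f t ∈ S.internalOff v := by
  have hft : f t ≠ x ∧ f t ≠ v := by
    have : f t ∈ Set.range f := ⟨t, rfl⟩
    rwa [hran] at this
  rw [internalOff, Set.mem_ofPred_eq, Ne, T.rot_eq_iff, Ne, S.rot_eq_iff, ← not_or, not_iff_not]
  have hmem : ∀ j, t ∈ T.legs j ↔ f t ∈ (T.legs j).map f := fun j =>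
    (List.mem_map_of_injective hf).symm
  constructor
  · rintro ⟨j, h⟩
    rw [hmem] at h
    by_cases hji : j = i
    · subst hji
      rw [hi] at h
      simp only [List.mem_append, hM] at h
      rcases h with (h | h) | h
      · exact Or.inl ⟨j, by rw [hlegs]; simp [h]⟩
      · exact Or.inr (Or.inr h)
      · exact Or.inl ⟨j, by rw [hlegs]; simp [h]⟩
    · rw [hj j hji] at h
      exact Or.inl ⟨j, h⟩
  · rintro (⟨j, h⟩ | h)
    · refine ⟨j, ?_⟩
      rw [hmem]
      by_cases hji : j = i
      · subst hji
        rw [hi]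
        rw [hlegs] at h
        simp only [List.mem_append, List.mem_singleton, hft.1, or_false] at h ⊢
        tauto
      · rwa [hj j hji]
    · refine ⟨i, ?_⟩
      rw [hmem, hi]
      simp only [List.mem_append, hM]
      rcases h with h | h
      exacts [absurd h hft.2, Or.inl (Or.inr h)]

theorem IsResolution.isTransversal_preimage {R : Finset S.H} {f : T.H → S.H}
    (hf : Function.Injective f) (hran : Set.range f = {h | h ≠ x ∧ h ≠ v})
    (hrot : ∀ h, T.rot h ≠ h → f (T.rot h) = S.rot (f h))
    (hint : ∀ t, T.rot t ≠ t ↔ f t ∈ S.internalOff v)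
    (hx : S.rot x = x)
    (hR : IsTransversal S.rot (S.internalOff v) R) :
    IsTransversal T.rot T.internal (R.preimage f hf.injOn) := by
  refine ⟨fun r hr => (hint r).2 (hR.1 _ (Finset.mem_preimage.1 hr)), fun h hh => ?_⟩
  have hiff : ∀ r, SameOrbit T.rot r h ↔ SameOrbit S.rot (f r) (f h) := by
    intro r
    have h1 := hrot h hh
    have h2 := hrot (T.rot h) fun e => hh (T.rot_injective e)
    simp only [SameOrbit, ← h1, ← h2, hf.eq_iff]
  obtain ⟨r, ⟨hr, ho⟩, hu⟩ := hR.2 _ ((hint h).1 hh)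
  have hrr : r ∈ Set.range f := by
    rw [hran]
    refine ⟨?_, ?_⟩
    · rintro rfl
      exact (hR.1 _ hr).1 hx
    · rintro rfl
      exact (hR.1 _ hr).2 (Or.inl rfl)
  obtain ⟨t, rfl⟩ := hrr
  refine ⟨t, ⟨Finset.mem_preimage.2 hr, (hiff t).2 ho⟩, ?_⟩
  rintro t' ⟨ht', ho'⟩
  exact hf (hu (f t') ⟨Finset.mem_preimage.1 ht', (hiff t').1 ho'⟩)

end SlDiagram

namespace WeightData

variable {K : Type*} [CommRing K] {n : ℕ} {C : Type*} [Fintype C]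
  {B : Type*} [Ring B] [Algebra K B] (X : WeightData K n C B)

/-- The colouring `c` with the colours of the edge `{x, v}` changed so that `v` gets `γ`. -/
def recolor {H : Type*} (x v : H) (c : H → C) (γ : C) : H → C := by
  classical exact Function.update (Function.update c x (X.dual γ)) v γ

section

variable {H : Type*} {x v : H}

theorem recolor_v (c : H → C) (γ : C) : X.recolor x v c γ v = γ := by
  simp [recolor]

theorem recolor_x (hxv : x ≠ v) (c : H → C) (γ : C) : X.recolor x v c γ x = X.dual γ := by
  simp [recolor, hxv]

theorem recolor_of_ne {h : H} (hx : h ≠ x) (hv : h ≠ v) (c : H → C) (γ : C) :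
    X.recolor x v c γ h = c h := by
  simp [recolor, hx, hv]

end

theorem recolor_mem {S : SlDiagram n} {x v : S.H} (hxv : S.edge x = v) (c : X.Coloring S)
    (γ : C) (h : S.H) :
    X.recolor x v c.1 γ (S.edge h) = X.dual (X.recolor x v c.1 γ h) := by
  have hvx : S.edge v = x := by rw [← hxv, S.edge_edge]
  have hne : x ≠ v := fun e => S.edge_ne x (hxv.trans e.symm)
  by_cases h1 : h = x
  · rw [h1, hxv, recolor_v, recolor_x X hne, X.dual_dual]
  by_cases h2 : h = v
  · rw [h2, hvx, recolor_v, recolor_x X hne]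
  rw [recolor_of_ne X h1 h2, recolor_of_ne X _ _, c.2]
  · rintro rfl
    exact h2 (by rw [← hxv, S.edge_edge])
  · rintro rfl
    exact h1 (by rw [← hvx, S.edge_edge])

/-- A colouring is determined by the colour of one edge and the other colours. -/
def coloringEquiv {S : SlDiagram n} {x v : S.H} (hxv : S.edge x = v) (γ₀ : C) :
    {c : X.Coloring S // c.1 v = γ₀} × C ≃ X.Coloring S where
  toFun p := ⟨X.recolor x v p.1.1.1 p.2, X.recolor_mem hxv _ _⟩
  invFun c := (⟨⟨X.recolor x v c.1 γ₀, X.recolor_mem hxv _ _⟩, X.recolor_v _ _⟩, c.1 v)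
  left_inv := by
    rintro ⟨⟨c, hc⟩, γ⟩
    have hne : x ≠ v := fun e => S.edge_ne x (hxv.trans e.symm)
    refine Prod.ext (Subtype.ext (Subtype.ext (funext fun h => ?_))) (X.recolor_v _ _)
    show X.recolor x v (X.recolor x v c.1 γ) γ₀ h = c.1 h
    by_cases h2 : h = v
    · rw [h2, recolor_v, hc]
    by_cases h1 : h = x
    · rw [h1, recolor_x X hne, ← hc, ← c.2, ← hxv, S.edge_edge]
    rw [recolor_of_ne X h1 h2, recolor_of_ne X h1 h2]
  right_inv := by
    intro c
    have hne : x ≠ v := fun e => S.edge_ne x (hxv.trans e.symm)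
    refine Subtype.ext (funext fun h => ?_)
    show X.recolor x v (X.recolor x v c.1 γ₀) (c.1 v) h = c.1 h
    by_cases h2 : h = v
    · rw [h2, recolor_v]
    by_cases h1 : h = x
    · rw [h1, recolor_x X hne, ← c.2, ← hxv, S.edge_edge]
    rw [recolor_of_ne X h1 h2, recolor_of_ne X h1 h2]

instance {S : SlDiagram n} (v : S.H) (γ₀ : C) : Fintype {c : X.Coloring S // c.1 v = γ₀} := by
  classical exact inferInstance

/-- Colourings of a resolution are colourings of `S` with a fixed colour on the edge that is
removed. -/
def restrictEquiv {S T : SlDiagram n} {x v : S.H} (hxv : S.edge x = v) (γ₀ : C)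
    {f : T.H → S.H} (hf : Function.Injective f) (hran : Set.range f = {h | h ≠ x ∧ h ≠ v})
    (hedge : ∀ h, f (T.edge h) = S.edge (f h)) :
    {c : X.Coloring S // c.1 v = γ₀} ≃ X.Coloring T := by
  have hne : x ≠ v := fun e => S.edge_ne x (hxv.trans e.symm)
  have hvx : S.edge v = x := by rw [← hxv, S.edge_edge]
  have hx : ¬ ∃ t, f t = x := fun h => by
    have : x ∈ Set.range f := h
    rw [hran] at this; exact this.1 rfl
  have hv : ¬ ∃ t, f t = v := fun h => by
    have : v ∈ Set.range f := h
    rw [hran] at this; exact this.2 rfl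
  refine Equiv.ofBijective (fun c => ⟨c.1.1 ∘ f, fun h => by
    simp only [Function.comp_apply, hedge, c.1.2]⟩) ⟨?_, ?_⟩
  · rintro ⟨c, hc⟩ ⟨d, hd⟩ hcd
    have hcd' : ∀ t, c.1 (f t) = d.1 (f t) := fun t => congrFun (congrArg Subtype.val hcd) t
    refine Subtype.ext (Subtype.ext (funext fun h => ?_))
    by_cases h2 : h = v
    · rw [h2, hc, hd]
    by_cases h1 : h = x
    · rw [h1, ← hvx, c.2, d.2, hc, hd]
    obtain ⟨t, rfl⟩ : h ∈ Set.range f := by rw [hran]; exact ⟨h1, h2⟩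
    exact hcd' t
  · rintro ⟨d, hd⟩
    let c : S.H → C := Function.extend f d (X.recolor x v (fun _ => γ₀) γ₀)
    have hcx : c x = X.dual γ₀ := by
      simp only [c, Function.extend_apply' _ _ _ hx, recolor_x X hne]
    have hcv : c v = γ₀ := by
      simp only [c, Function.extend_apply' _ _ _ hv, recolor_v X]
    have hct : ∀ t, c (f t) = d t := fun t => hf.extend_apply _ _ _
    refine ⟨⟨⟨c, fun h => ?_⟩, hcv⟩, Subtype.ext (funext hct)⟩
    by_cases h2 : h = v
    · rw [h2, hvx, hcx, hcv]
    by_cases h1 : h = x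
    · rw [h1, hxv, hcx, hcv, X.dual_dual]
    obtain ⟨t, rfl⟩ : h ∈ Set.range f := by rw [hran]; exact ⟨h1, h2⟩
    rw [← hedge, hct, hct, hd]

/-- The state sum of a resolution as a sum over colourings of `S`. -/
theorem weight_resolution {S T : SlDiagram n} {x v : S.H} {i : Fin n} {l₁ l₂ M : List S.H}
    (hxv : S.edge x = v) (hv : S.rot v ≠ v) (hlegs : S.legs i = l₁ ++ [x] ++ l₂)
    (hM : ∀ h, h ∈ M ↔ h = S.rot v ∨ h = S.rot (S.rot v))
    (hT : S.IsResolution T x v i (l₁ ++ M ++ l₂)) (γ₀ : C) {R : Finset S.H}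
    (hR : IsTransversal S.rot (S.internalOff v) R) :
    X.weight T = ∑ c : {c : X.Coloring S // c.1 v = γ₀},
      X.term S.rot R (Function.update S.legs i (l₁ ++ M ++ l₂)) c.1.1 := by
  obtain ⟨f, hf, hran, hedge, hrot, hi, hj⟩ := hT
  have hint := SlDiagram.IsResolution.rot_ne_iff hlegs hf hran hi hM hj
  have hx : S.rot x = x := (S.rot_eq_iff x).2 ⟨i, by rw [hlegs]; simp⟩
  have hRT := SlDiagram.IsResolution.isTransversal_preimage hf hran hrot hint hx hR
  rw [X.weight_eq T hRT]
  symm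
  refine Fintype.sum_equiv (X.restrictEquiv hxv γ₀ hf hran hedge) _ _ fun c => ?_
  have hRr : ∀ r ∈ R, r ∈ Set.range f := by
    intro r hr
    rw [hran]
    refine ⟨?_, ?_⟩
    · rintro rfl
      exact (hR.1 _ hr).1 hx
    · rintro rfl
      exact (hR.1 _ hr).2 (Or.inl rfl)
  unfold term
  congr 1
  · rw [← Finset.prod_preimage_of_bij f R]
    swap
    · exact ⟨fun r hr => hr, hf.injOn, fun r hr => by
        obtain ⟨t, rfl⟩ := hRr r hr
        exact ⟨t, hr, rfl⟩⟩
    refine Finset.prod_congr rfl fun r hr => ?_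
    have h1 := hrot r (hRT.1 r hr)
    have h2 := hrot (T.rot r) fun e => hRT.1 r hr (T.rot_injective e)
    rw [← h1, ← h2]
    rfl
  · congr 1
    funext j
    by_cases hji : j = i
    · subst hji
      rw [Function.update_self, ← hi, List.map_map]
      rfl
    · rw [Function.update_of_ne hji, ← hj j hji, List.map_map]
      rfl

/-- State sums satisfy the `STU` relation: in the state sum of `S`, the sum over the colour of the
edge `{x, v}` turns the structure constants into a commutator of the operators of the two legs. -/
theorem weight_stu {S T U : SlDiagram n} (h : S.IsSTU T U) :
    X.weight S = X.weight T - X.weight U := by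
  classical
  obtain ⟨i, x, v, l₁, l₂, hxv, hv, hlegs, hT, hU⟩ := h
  have hne : x ≠ v := fun e => S.edge_ne x (hxv.trans e.symm)
  have hx : S.rot x = x := (S.rot_eq_iff x).2 ⟨i, by rw [hlegs]; simp⟩
  have hleg : ∀ j, ∀ h ∈ S.legs j, h ≠ v := by
    rintro j h hh rfl
    exact hv ((S.rot_eq_iff h).2 ⟨j, hh⟩)
  rcases isEmpty_or_nonempty C with hC | ⟨⟨γ₀⟩⟩
  · -- without colours, a diagram that has a half-edge has no colouring; `T` and `U` have one
    have key : ∀ D : SlDiagram n, Nonempty D.H → X.weight D = 0 := by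
      rintro D ⟨h⟩
      have : IsEmpty (X.Coloring D) := ⟨fun c => hC.elim (c.1 h)⟩
      exact Finset.sum_of_isEmpty _
    have hne' : ∀ {D : SlDiagram n} {L : List S.H}, S.IsResolution D x v i L → Nonempty D.H := by
      rintro D L ⟨f, -, hran, -⟩
      have : S.rot v ∈ Set.range f := by
        rw [hran]
        exact ⟨fun e => hv (S.rot_injective (by rw [e, hx])), hv⟩
      exact ⟨this.choose⟩
    rw [key S ⟨v⟩, key T (hne' hT), key U (hne' hU), sub_zero]
  -- all three state sums become sums over the colourings of `S` with the colour `γ₀` at `v`, and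
  -- that of `S` has an additional sum over the actual colour of `v`
  obtain ⟨R, hR⟩ := S.exists_transversal_off v
  rw [X.weight_eq S (SlDiagram.isTransversal_insert hv hR),
    X.weight_resolution hxv hv hlegs (by simp [or_comm]) hT γ₀ hR,
    X.weight_resolution hxv hv hlegs (by simp) hU γ₀ hR,
    ← Fintype.sum_equiv (X.coloringEquiv hxv γ₀) _ _ fun _ => rfl, Fintype.sum_prod_type,
    ← Finset.sum_sub_distrib]
  refine Finset.sum_congr rfl fun c _ => ?_
  obtain ⟨P, Q, hPQ⟩ := exists_strandProd_eq
    (fun j => ((S.legs j).map fun h => X.ρ j (c.1.1 h)).prod) i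
  set a := S.rot v with ha
  set b := S.rot a with hb
  have hax : a ≠ x := fun e => hv (S.rot_injective (by rw [← ha, e, hx]))
  have hbx : b ≠ x := fun e => hax (S.rot_injective (by rw [← hb, e, hx]))
  have hbv : b ≠ v := fun e => hv (by
    have := S.rot_rot_rot v
    rw [← ha, ← hb, e] at this
    exact this)
  have hnd := S.nodup i
  rw [hlegs] at hnd
  have hx1 : ∀ h ∈ l₁, h ≠ x := by
    rintro h hh rfl
    simp only [List.append_assoc, List.singleton_append, List.nodup_append, List.mem_cons] at hnd
    exact hnd.2.2 h hh h (Or.inl rfl) rfl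
  have hx2 : ∀ h ∈ l₂, h ≠ x := by
    rintro h hh rfl
    simp only [List.append_assoc, List.singleton_append, List.nodup_append, List.nodup_cons] at hnd
    exact hnd.2.1.1 hh
  have hv1 : ∀ h ∈ l₁, h ≠ v := fun h hh => hleg i h (by rw [hlegs]; simp [hh])
  have hv2 : ∀ h ∈ l₂, h ≠ v := fun h hh => hleg i h (by rw [hlegs]; simp [hh])
  set p₁ := (l₁.map fun h => X.ρ i (c.1.1 h)).prod with hp₁
  set p₂ := (l₂.map fun h => X.ρ i (c.1.1 h)).prod with hp₂
  set k := ∏ r ∈ R, X.f (c.1.1 r) (c.1.1 (S.rot r)) (c.1.1 (S.rot (S.rot r))) with hk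
  have hTU : ∀ M : List S.H, X.term S.rot R (Function.update S.legs i (l₁ ++ M ++ l₂)) c.1.1 =
      k • (P * (p₁ * (M.map fun h => X.ρ i (c.1.1 h)).prod * p₂) * Q) := by
    intro M
    rw [term, hPQ]
    · simp [hp₁, hp₂, hk, mul_assoc]
    · intro j hj
      rw [Function.update_of_ne hj]
  have hS : ∀ γ, X.term S.rot (insert v R) S.legs (X.coloringEquiv hxv γ₀ (c, γ)).1 =
      k • (P * (p₁ * (X.f γ (c.1.1 a) (c.1.1 b) • X.ρ i (X.dual γ)) * p₂) * Q) := by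
    intro γ
    have hcol : ∀ h, h ≠ x → h ≠ v → X.recolor x v c.1.1 γ h = c.1.1 h := fun h h1 h2 =>
      X.recolor_of_ne h1 h2 _ _
    change X.term S.rot (insert v R) S.legs (X.recolor x v c.1.1 γ) = _
    rw [term, hPQ]
    · rw [Finset.prod_insert (SlDiagram.notMem_of_isTransversal_off hR), X.recolor_v,
        ← ha, ← hb, hcol a hax hv, hcol b hbx hbv, hlegs]
      have e1 : (l₁.map fun h => X.ρ i (X.recolor x v c.1.1 γ h)).prod = p₁ := by
        rw [hp₁]
        exact congrArg _ (List.map_congr_left fun h hh => by rw [hcol h (hx1 h hh) (hv1 h hh)])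
      have e2 : (l₂.map fun h => X.ρ i (X.recolor x v c.1.1 γ h)).prod = p₂ := by
        rw [hp₂]
        exact congrArg _ (List.map_congr_left fun h hh => by rw [hcol h (hx2 h hh) (hv2 h hh)])
      have e3 : ∏ r ∈ R, X.f (X.recolor x v c.1.1 γ r) (X.recolor x v c.1.1 γ (S.rot r))
          (X.recolor x v c.1.1 γ (S.rot (S.rot r))) = k := by
        rw [hk]
        refine Finset.prod_congr rfl fun r hr => ?_
        have hr0 := hR.1 r hr
        have E := sameOrbit_equivalence S.rot_rot_rot
        have hgood : ∀ h, SameOrbit S.rot h r → h ≠ x ∧ h ≠ v := by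
          intro h ho
          refine ⟨?_, ?_⟩
          · rintro rfl
            rcases E.symm ho with e | e | e
            · exact hr0.1 (by rw [e, hx])
            · exact hr0.1 (by rw [e, hx, hx])
            · exact hr0.1 (by rw [e, hx, hx, hx])
          · rintro rfl
            exact hr0.2 (E.symm ho)
        have g0 := hgood r (Or.inl rfl)
        have g1 := hgood (S.rot r) (Or.inr (Or.inl rfl))
        have g2 := hgood (S.rot (S.rot r)) (Or.inr (Or.inr rfl))
        rw [hcol _ g0.1 g0.2, hcol _ g1.1 g1.2, hcol _ g2.1 g2.2]
      rw [e3]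
      simp only [List.map_append, List.prod_append, List.map_cons, List.map_nil, List.prod_cons,
        List.prod_nil, mul_one, e1, e2, X.recolor_x hne]
      simp only [mul_smul_comm, smul_mul_assoc, smul_smul, mul_comm k]
    · intro j hj
      refine congrArg _ (List.map_congr_left fun h hh => ?_)
      rw [hcol h _ (hleg j h hh)]
      rintro rfl
      exact S.disjoint i j hj.symm (by rw [hlegs]; simp) hh
  simp only [hTU, hS]
  rw [← Finset.smul_sum, ← Finset.sum_mul, ← Finset.mul_sum, ← Finset.sum_mul, ← Finset.mul_sum,
    ← X.stu, ← smul_sub, ← sub_mul, ← mul_sub, ← sub_mul, ← mul_sub]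
  simp

/-- The state sum as a linear map on `A^{sl}`. -/
def weightHom : Asl K n →ₗ[K] B :=
  (stuSubmodule K n).liftQ
    (Finsupp.lift B K (SlDiagram.Class n) (Quot.lift X.weight fun _ _ => X.weight_eq_of_iso)) <| by
      rw [stuSubmodule, Submodule.span_le]
      rintro _ ⟨S, T, U, h, rfl⟩
      simp only [SetLike.mem_coe, LinearMap.mem_ker, map_sub, Finsupp.lift_apply,
        Finsupp.sum_single_index, zero_smul, one_smul, X.weight_stu h, sub_self]

theorem weightHom_mk (D : SlDiagram n) : X.weightHom (Asl.mk K D) = X.weight D := by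
  simp [weightHom, Asl.mk]

end WeightData

/-! ### State sums of pure braid chord diagrams -/

section StrandProd

variable {n : ℕ} {B : Type*} [Monoid B]

theorem list_prod_map_mul_of_commute {ι : Type*} (l : List ι) (hl : l.Nodup) (F G : ι → B)
    (h : ∀ i j, i ≠ j → Commute (F i) (G j)) :
    (l.map fun i => F i * G i).prod = (l.map F).prod * (l.map G).prod := by
  induction l with
  | nil => simp
  | cons i l ih =>
    rw [List.nodup_cons] at hl
    have hc : Commute (G i) (l.map F).prod := by
      refine Commute.list_prod_right _ _ fun x hx => ?_
      obtain ⟨j, hj, rfl⟩ := List.mem_map.1 hx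
      exact (h j i fun e => hl.1 (e ▸ hj)).symm
    simp only [List.map_cons, List.prod_cons, ih hl.2, mul_assoc]
    rw [← mul_assoc (G i), hc.eq, mul_assoc]

theorem strandProd_mul (F G : Fin n → B) (h : ∀ i j, i ≠ j → Commute (F i) (G j)) :
    (strandProd fun i => F i * G i) = strandProd F * strandProd G :=
  list_prod_map_mul_of_commute _ (List.nodup_finRange n) F G h

/-- Operators on different strands commute, so that a product may be taken strand by strand or
chord by chord. -/
theorem strandProd_list_prod {κ : Type*} (l : List κ) (A : Fin n → κ → B)
    (h : ∀ i j, i ≠ j → ∀ k k', Commute (A i k) (A j k')) :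
    (strandProd fun i => (l.map (A i)).prod) = (l.map fun k => strandProd fun i => A i k).prod := by
  induction l with
  | nil => simp [strandProd]
  | cons k l ih =>
    simp only [List.map_cons, List.prod_cons]
    rw [strandProd_mul, ih]
    intro i j hij
    refine Commute.list_prod_right _ _ fun x hx => ?_
    obtain ⟨k', -, rfl⟩ := List.mem_map.1 hx
    exact h i j hij k k'

theorem list_prod_map_mulSingle {ι : Type*} [DecidableEq ι] (l : List ι) (hl : l.Nodup) (i : ι)
    (a : B) : (l.map (Pi.mulSingle (M := fun _ => B) i a)).prod = if i ∈ l then a else 1 := by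
  induction l with
  | nil => simp
  | cons j l ih =>
    rw [List.nodup_cons] at hl
    rw [List.map_cons, List.prod_cons, ih hl.2]
    by_cases h : j = i
    · subst h
      simp [hl.1]
    · simp [h, Ne.symm h]

theorem strandProd_pair {i j : Fin n} (hij : i ≠ j) (a b : B) (hab : Commute a b) :
    (strandProd fun k => if k = i then a else if k = j then b else 1) = a * b := by
  have : (fun k => if k = i then a else if k = j then b else 1) = fun k =>
      Pi.mulSingle (M := fun _ => B) i a k * Pi.mulSingle (M := fun _ => B) j b k := by
    funext k
    by_cases h1 : k = i
    · subst h1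
      simp [hij]
    · by_cases h2 : k = j
      · subst h2
        simp [h1]
      · simp [h1, h2]
  rw [this, strandProd_mul, strandProd, strandProd, list_prod_map_mulSingle _ (List.nodup_finRange n),
    list_prod_map_mulSingle _ (List.nodup_finRange n)]
  · simp
  · intro k l hkl
    by_cases h1 : k = i
    · by_cases h2 : l = j
      · subst h1 h2
        simpa using hab
      · simp [h2]
    · simp [h1]

end StrandProd

/-- A product of sums is a sum over choice functions of products. -/
theorem sum_list_prod_finRange {B C : Type*} [Semiring B] [Fintype C] (m : ℕ)
    (G : Fin m → C → B) : ∑ g : Fin m → C, ((List.finRange m).map fun k => G k (g k)).prod =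
      ((List.finRange m).map fun k => ∑ a, G k a).prod := by
  induction m with
  | zero => simp
  | succ m ih =>
    rw [← Fintype.sum_equiv (Fin.consEquiv fun _ => C) _ _ fun _ => rfl, Fintype.sum_prod_type]
    simp only [Fin.consEquiv_apply, List.finRange_succ, List.map_cons, List.map_map,
      List.prod_cons, Function.comp_def, Fin.cons_zero, Fin.cons_succ]
    rw [← ih fun k => G k.succ, Finset.sum_mul_sum]

theorem list_prod_filterMap {κ ι B : Type*} [Monoid B] (l : List κ) (p : κ → Prop)
    [DecidablePred p] (q : ∀ k, p k → ι) (F : ι → B) :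
    ((l.filterMap fun k => if h : p k then some (q k h) else none).map F).prod =
      (l.map fun k => if h : p k then F (q k h) else 1).prod := by
  induction l with
  | nil => rfl
  | cons k l ih =>
    by_cases h : p k
    · simp only [List.filterMap_cons, h, dite_true, List.map_cons, List.prod_cons, ih]
    · simp only [List.filterMap_cons, h, dite_false, List.map_cons, List.prod_cons, ih, one_mul]

namespace Chord

variable {n : ℕ}

/-- The first strand met by a chord. -/
def lo (c : Chord n) : Fin n := c.1.inf

/-- The last strand met by a chord. -/
def hi (c : Chord n) : Fin n := c.1.sup

theorem lo_lt_hi (c : Chord n) : c.lo < c.hi := by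
  obtain ⟨c, hc⟩ := c
  induction c using Sym2.ind with
  | _ a b =>
    have hab : a ≠ b := fun h => hc (Sym2.mk_isDiag_iff.2 h)
    simpa [lo, hi, eq_comm] using hab

theorem eq_mk (c : Chord n) : c.1 = s(c.lo, c.hi) := by
  obtain ⟨c, hc⟩ := c
  induction c using Sym2.ind with
  | _ a b =>
    rcases le_total a b with h | h <;> simp [lo, hi, h]

theorem eq_chord (c : Chord n) : c = chord c.lo c.hi c.lo_lt_hi.ne := Subtype.ext c.eq_mk

theorem mem_iff (c : Chord n) (i : Fin n) : i ∈ c.1 ↔ i = c.lo ∨ i = c.hi := by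
  rw [c.eq_mk, Sym2.mem_iff]

theorem ext {c c' : Chord n} (h1 : c.lo = c'.lo) (h2 : c.hi = c'.hi) : c = c' :=
  Subtype.ext (by rw [c.eq_mk, c'.eq_mk, h1, h2])

theorem ite_mem {α β : Type*} (c : Chord n) (i : Fin n) (F : Fin n → α → β) (a b : α) (e : β) :
    (if i ∈ c.1 then F i (if i = c.lo then a else b) else e) =
      if i = c.lo then F c.lo a else if i = c.hi then F c.hi b else e := by
  simp only [mem_iff]
  have := c.lo_lt_hi.ne'
  by_cases e1 : i = c.lo
  · simp [e1]
  · by_cases e2 : i = c.hi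
    · simp [e2, this]
    · simp [e1, e2]

theorem other_eq (c : Chord n) {i : Fin n} (h : i ∈ c.1) :
    Sym2.Mem.other h = if i = c.lo then c.hi else c.lo := by
  have h1 := Sym2.other_spec h
  have h2 := Sym2.other_ne c.2 h
  have h3 : Sym2.Mem.other h = c.lo ∨ Sym2.Mem.other h = c.hi := (c.mem_iff _).1 (Sym2.other_mem h)
  rcases (c.mem_iff i).1 h with e | e
  · rw [if_pos e]
    exact h3.resolve_left fun e' => h2 (e'.trans e.symm)
  · rw [if_neg (e.trans_ne c.lo_lt_hi.ne')]
    exact h3.resolve_right fun e' => h2 (e'.trans e.symm)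

end Chord

namespace WeightData

variable {K : Type*} [CommRing K] {n : ℕ} {C : Type*} [Fintype C]
  {B : Type*} [Ring B] [Algebra K B] (X : WeightData K n C B)

/-- The operator of a chord: the Casimir element acting on the two strands. -/
def chordOp (c : Chord n) : B := ∑ a, X.ρ c.lo a * X.ρ c.hi (X.dual a)

/-- A colouring of a chord diagram assigns any colour to the lower end of each chord. -/
def coloringToSl (w : PbDiagram n) : X.Coloring (PbDiagram.toSl w) ≃ (Fin w.length → C) where
  toFun c k := c.1 ⟨(k, (w.get k).lo), ((w.get k).mem_iff _).2 (Or.inl rfl)⟩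
  invFun g := ⟨fun p => if p.1.2 = (w.get p.1.1).lo then g p.1.1 else X.dual (g p.1.1), by
    rintro ⟨⟨k, i⟩, h⟩
    show (if Sym2.Mem.other h = (w.get k).lo then g k else X.dual (g k)) =
      X.dual (if i = (w.get k).lo then g k else X.dual (g k))
    rw [Chord.other_eq]
    split_ifs with h1 h2 h2
    · exact absurd h2 (w.get k).lo_lt_hi.ne'
    · rfl
    · exact (X.dual_dual _).symm
    · exact absurd rfl h2⟩
  left_inv := by
    rintro ⟨c, hc⟩
    refine Subtype.ext (funext ?_)
    rintro ⟨⟨k, i⟩, h⟩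
    show (if i = (w.get k).lo then c ⟨(k, (w.get k).lo), _⟩
      else X.dual (c ⟨(k, (w.get k).lo), _⟩)) = c ⟨(k, i), h⟩
    split_ifs with h1
    · subst h1; rfl
    · refine (hc _).symm.trans ?_
      refine congrArg c (Subtype.ext (Prod.ext rfl ?_))
      show Sym2.Mem.other _ = i
      rw [Chord.other_eq, if_pos rfl]
      exact (((w.get k).mem_iff i).1 h).resolve_left h1 |>.symm
  right_inv g := by
    funext k
    exact if_pos rfl

/-- The state sum of a chord diagram is the product of the operators of its chords. -/
theorem weight_toSl (w : PbDiagram n) :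
    X.weight (PbDiagram.toSl w) = (w.map X.chordOp).prod := by
  classical
  have hR : IsTransversal (PbDiagram.toSl w).rot (PbDiagram.toSl w).internal ∅ :=
    ⟨by simp, fun h hh => absurd rfl hh⟩
  rw [X.weight_eq _ hR]
  have hw : w.map X.chordOp = (List.finRange w.length).map fun k => X.chordOp (w.get k) := by
    conv_lhs => rw [← List.ofFn_get w, List.ofFn_eq_map, List.map_map]
    rfl
  simp only [hw, chordOp]
  rw [← sum_list_prod_finRange]
  refine Fintype.sum_equiv (X.coloringToSl w) _ _ fun c => ?_
  obtain ⟨g, rfl⟩ := (X.coloringToSl w).symm.surjective c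
  rw [Equiv.apply_symm_apply, term, Finset.prod_empty, one_smul]
  have h1 : ∀ i, (((PbDiagram.toSl w).legs i).map
      fun h => X.ρ i (((X.coloringToSl w).symm g).1 h)).prod =
      ((List.finRange w.length).map fun k => if i ∈ (w.get k).1 then
        X.ρ i (if i = (w.get k).lo then g k else X.dual (g k)) else 1).prod := by
    intro i
    exact list_prod_filterMap _ _ _ _
  simp only [h1]
  rw [strandProd_list_prod]
  · refine congrArg List.prod (List.map_congr_left fun k _ => ?_)
    rw [← strandProd_pair (w.get k).lo_lt_hi.ne _ _ (X.comm _ _ (w.get k).lo_lt_hi.ne _ _)]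
    congr 1
    funext i
    exact (w.get k).ite_mem i X.ρ _ _ _
  · intro i j hij k k'
    split_ifs
    all_goals first | exact X.comm _ _ hij _ _ | simp

end WeightData

/-! ### Chord diagrams with labelled chords -/

/-- Chord diagrams whose chords are labelled by a type `κ`: the chord `ch k` has the label `k`,
and the list `l` contains each label once, in the order in which the chords are met. -/
structure LabelledDiagram (n : ℕ) (κ : Type) where
  ch : κ → Chord n
  l : List κ
  nodup : l.Nodup
  mem : ∀ k, k ∈ l

namespace LabelledDiagram

variable {n : ℕ} {κ : Type}

/-- The ends of the chords in a family: `(k, i)` is the end of the chord `k` on the strand `i`. -/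
abbrev Ends (ch : κ → Chord n) : Type := {p : κ × Fin n // p.2 ∈ (ch p.1).1}

/-- The ends on the strand `i` of the chords in a list. -/
def endsOn (ch : κ → Chord n) (l : List κ) (i : Fin n) : List (Ends ch) :=
  l.filterMap fun k => if h : i ∈ (ch k).1 then some ⟨(k, i), h⟩ else none

theorem mem_endsOn (ch : κ → Chord n) (l : List κ) (i : Fin n) (p : Ends ch) :
    p ∈ endsOn ch l i ↔ p.1.1 ∈ l ∧ p.1.2 = i := by
  obtain ⟨⟨k, j⟩, hp⟩ := p
  simp only [endsOn, List.mem_filterMap]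
  constructor
  · rintro ⟨a, hal, ha⟩
    split_ifs at ha with h
    simp only [Option.some.injEq, Subtype.mk.injEq, Prod.mk.injEq] at ha
    exact ⟨ha.1 ▸ hal, ha.2.symm⟩
  · rintro ⟨hk, rfl⟩
    exact ⟨k, hk, dif_pos hp⟩

theorem nodup_endsOn (ch : κ → Chord n) (l : List κ) (hl : l.Nodup) (i : Fin n) :
    (endsOn ch l i).Nodup := by
  refine List.Nodup.filterMap ?_ hl
  intro a b p ha hb
  simp only [Option.mem_def] at ha hb
  split_ifs at ha hb
  simp only [Option.some.injEq] at ha hb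
  have := ha.trans hb.symm
  simp only [Subtype.mk.injEq, Prod.mk.injEq] at this
  exact this.1

theorem endsOn_append (ch : κ → Chord n) (l l' : List κ) (i : Fin n) :
    endsOn ch (l ++ l') i = endsOn ch l i ++ endsOn ch l' i :=
  List.filterMap_append

theorem endsOn_nil (ch : κ → Chord n) (i : Fin n) : endsOn ch [] i = [] := rfl

theorem endsOn_cons_pos (ch : κ → Chord n) (k : κ) (l : List κ) {i : Fin n} (h : i ∈ (ch k).1) :
    endsOn ch (k :: l) i = ⟨(k, i), h⟩ :: endsOn ch l i := by
  simp [endsOn, h]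

theorem endsOn_cons_neg (ch : κ → Chord n) (k : κ) (l : List κ) {i : Fin n} (h : i ∉ (ch k).1) :
    endsOn ch (k :: l) i = endsOn ch l i := by
  simp [endsOn, h]

theorem endsOn_pair_comm (ch : κ → Chord n) (k k' : κ) {i : Fin n}
    (h : i ∈ (ch k).1 → i ∉ (ch k').1) : endsOn ch [k, k'] i = endsOn ch [k', k] i := by
  by_cases h1 : i ∈ (ch k).1
  · rw [endsOn_cons_pos ch k _ h1, endsOn_cons_neg ch k' _ (h h1), endsOn_cons_neg ch k' _ (h h1),
      endsOn_cons_pos ch k _ h1]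
  · rw [endsOn_cons_neg ch k _ h1]
    by_cases h2 : i ∈ (ch k').1
    · rw [endsOn_cons_pos ch k' _ h2, endsOn_cons_pos ch k' _ h2, endsOn_cons_neg ch k _ h1]
    · rw [endsOn_cons_neg ch k' _ h2, endsOn_cons_neg ch k' _ h2, endsOn_cons_neg ch k _ h1]

/-- The other end of the same chord. -/
def otherEnd (ch : κ → Chord n) (p : Ends ch) : Ends ch :=
  ⟨(p.1.1, Sym2.Mem.other p.2), Sym2.other_mem p.2⟩

theorem otherEnd_otherEnd (ch : κ → Chord n) (p : Ends ch) : otherEnd ch (otherEnd ch p) = p := by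
  obtain ⟨⟨k, j⟩, hp⟩ := p
  exact Subtype.ext (Prod.ext rfl (Sym2.other_invol hp _))

theorem otherEnd_ne (ch : κ → Chord n) (p : Ends ch) : otherEnd ch p ≠ p := fun hp =>
  Sym2.other_ne (ch p.1.1).2 p.2 (congrArg (fun q => q.1.2) hp)

/-- A labelled chord diagram, seen as a string link diagram without internal vertices. -/
def toSl (D : LabelledDiagram n κ) : SlDiagram n where
  H := Ends D.ch
  finite := by
    have : Finite κ := Set.finite_univ_iff.1 (D.l.finite_toSet.subset fun k _ => D.mem k)
    infer_instance
  edge := otherEnd D.ch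
  edge_edge := otherEnd_otherEnd D.ch
  edge_ne := otherEnd_ne D.ch
  rot p := p
  rot_rot_rot _ := rfl
  legs := endsOn D.ch D.l
  nodup := nodup_endsOn D.ch D.l D.nodup
  disjoint i j hij p hi hj :=
    hij (((mem_endsOn _ _ i p).1 hi).2.symm.trans ((mem_endsOn _ _ j p).1 hj).2)
  rot_eq_iff p := ⟨fun _ => ⟨p.1.2, (mem_endsOn _ _ _ p).2 ⟨D.mem _, rfl⟩⟩, fun _ => rfl⟩
  connected p :=
    ⟨p.1.2, p, (mem_endsOn _ _ _ p).2 ⟨D.mem _, rfl⟩, Relation.ReflTransGen.refl⟩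

theorem toSl_iso (D : LabelledDiagram n κ) {w : PbDiagram n} (hw : D.l.map D.ch = w) :
    (PbDiagram.toSl w).Iso D.toSl := by
  subst hw
  classical
  let e : Fin (D.l.map D.ch).length ≃ κ :=
    (finCongr (List.length_map _)).trans (D.nodup.getEquivOfForallMemList D.l D.mem)
  have hch : ∀ k, (D.l.map D.ch).get k = D.ch (e k) := fun k => by simp [e]
  have hl : (List.finRange _).map e = D.l := by
    refine List.ext_getElem (by simp) fun m h1 h2 => ?_
    simp [e]
  let E : PbDiagram.Ends (D.l.map D.ch) ≃ Ends D.ch :=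
    (e.prodCongr (Equiv.refl _)).subtypeEquiv fun p => by
      rw [hch]; rfl
  refine ⟨E, ?_, fun _ => rfl, fun i => ?_⟩
  · rintro ⟨⟨k, i⟩, h⟩
    refine Subtype.ext (Prod.ext rfl ?_)
    show Sym2.Mem.other _ = Sym2.Mem.other _
    rw [Chord.other_eq, Chord.other_eq]
    simp only [hch]
    rfl
  · show (PbDiagram.endsOn _ i).map E = endsOn D.ch D.l i
    rw [endsOn]
    conv_rhs => rw [← hl]
    rw [PbDiagram.endsOn, List.map_filterMap, List.filterMap_map]
    congr 1
    funext k
    by_cases h : i ∈ (D.ch (e k)).1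
    · have h' : i ∈ ((D.l.map D.ch).get k).1 := by rw [hch]; exact h
      simp only [Function.comp_apply, dif_pos h, dif_pos h']
      rfl
    · have h' : i ∉ ((D.l.map D.ch).get k).1 := by rw [hch]; exact h
      simp only [Function.comp_apply, dif_neg h, dif_neg h']
      rfl

theorem mk_toSl (K : Type*) [CommRing K] (D : LabelledDiagram n κ) {w : PbDiagram n}
    (hw : D.l.map D.ch = w) : Asl.mk K D.toSl = Asl.mk K (PbDiagram.toSl w) := by
  rw [Asl.mk, Asl.mk, Quot.sound (D.toSl_iso hw)]

end LabelledDiagram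

/-! ### Two adjacent chords in a chord diagram -/

section Context

variable {n : ℕ} (x y : PbDiagram n)

/-- The labels of the chords of two chord diagrams. -/
abbrev Ctx : Type := Fin x.length ⊕ Fin y.length

/-- The chord with a given label. -/
def ctxChord : Ctx x y → Chord n := Sum.elim x.get y.get

/-- The diagram consisting of `x`, two chords labelled by `Bool`, and `y`. The chords in the
middle are met in the order `b, !b`. -/
def ctxDiagram (c : Bool → Chord n) (b : Bool) : LabelledDiagram n (Ctx x y ⊕ Bool) where
  ch := Sum.elim (ctxChord x y) c
  l := (List.finRange x.length).map (Sum.inl ∘ Sum.inl) ++ [Sum.inr b, Sum.inr !b] ++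
    (List.finRange y.length).map (Sum.inl ∘ Sum.inr)
  nodup := by
    have h1 := (List.nodup_finRange x.length).map
      (f := (Sum.inl ∘ Sum.inl : _ → Ctx x y ⊕ Bool)) (Sum.inl_injective.comp Sum.inl_injective)
    have h2 := (List.nodup_finRange y.length).map
      (f := (Sum.inl ∘ Sum.inr : _ → Ctx x y ⊕ Bool)) (Sum.inl_injective.comp Sum.inr_injective)
    simp only [List.nodup_append, h1, h2, List.nodup_cons]
    simp
  mem := by
    rintro ((k | k) | k)
    · simp
    · simp
    · cases k <;> cases b <;> simp

theorem ctxDiagram_map (c : Bool → Chord n) (b : Bool) :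
    (ctxDiagram x y c b).l.map (ctxDiagram x y c b).ch = x ++ [c b, c !b] ++ y := by
  have hx : (List.finRange x.length).map x.get = x := by
    rw [← List.ofFn_eq_map, List.ofFn_get]
  have hy : (List.finRange y.length).map y.get = y := by
    rw [← List.ofFn_eq_map, List.ofFn_get]
  conv_rhs => rw [← hx, ← hy]
  simp only [ctxDiagram, List.map_append, List.map_map]
  rfl

/-- Chords without a common strand can be interchanged: the string link diagrams are isomorphic. -/
theorem mk_toSl_comm (K : Type*) [CommRing K] (c c' : Chord n) (h : ∀ i, i ∈ c.1 → i ∉ c'.1) :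
    Asl.mk K (PbDiagram.toSl (x ++ [c, c'] ++ y)) =
      Asl.mk K (PbDiagram.toSl (x ++ [c', c] ++ y)) := by
  let d : Bool → Chord n := fun b => if b then c else c'
  have h1 := (ctxDiagram x y d true).mk_toSl K (ctxDiagram_map x y d true)
  have h2 := (ctxDiagram x y d false).mk_toSl K (ctxDiagram_map x y d false)
  refine h1.symm.trans (Eq.trans ?_ h2)
  suffices h : (ctxDiagram x y d true).toSl.Iso (ctxDiagram x y d false).toSl by
    rw [Asl.mk, Asl.mk, Quot.sound h]
  refine ⟨Equiv.refl _, fun _ => rfl, fun _ => rfl, fun i => ?_⟩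
  show List.map id _ = _
  rw [List.map_id]
  show LabelledDiagram.endsOn (Sum.elim (ctxChord x y) d) (_ ++ _ ++ _) i =
    LabelledDiagram.endsOn (Sum.elim (ctxChord x y) d) (_ ++ _ ++ _) i
  rw [LabelledDiagram.endsOn_append, LabelledDiagram.endsOn_append,
    LabelledDiagram.endsOn_append, LabelledDiagram.endsOn_append]
  rw [show ([Sum.inr true, Sum.inr !true] : List (Ctx x y ⊕ Bool)) = [.inr true, .inr false] from rfl,
    show ([Sum.inr false, Sum.inr !false] : List (Ctx x y ⊕ Bool)) = [.inr false, .inr true] from rfl,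
    LabelledDiagram.endsOn_pair_comm (Sum.elim (ctxChord x y) d) (.inr true) (.inr false) (h i)]

/-! ### Diagrams with one internal vertex -/

variable (σ : Fin 3 → Fin n)

/-- The half-edges of a diagram with chords labelled by `Ctx x y` and one internal vertex:
`(r, true)` lies at this vertex, and `(r, false)` is the other half of the same edge. -/
abbrev TriEnds : Type := LabelledDiagram.Ends (ctxChord x y) ⊕ (Fin 3 × Bool)

namespace TriEnds

variable {x y}

/-- The other half of the same edge. -/
def edge : TriEnds x y → TriEnds x y
  | .inl p => .inl (LabelledDiagram.otherEnd _ p)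
  | .inr (r, b) => .inr (r, !b)

/-- The cyclic order at the internal vertex. -/
def rot : TriEnds x y → TriEnds x y
  | .inl p => .inl p
  | .inr (r, false) => .inr (r, false)
  | .inr (r, true) => .inr (r + 1, true)

variable (x y)

/-- The ends of the chords of `x` on the strand `i`. -/
def before (i : Fin n) : List (TriEnds x y) :=
  (LabelledDiagram.endsOn (ctxChord x y) ((List.finRange x.length).map Sum.inl) i).map Sum.inl

/-- The ends of the chords of `y` on the strand `i`. -/
def after (i : Fin n) : List (TriEnds x y) :=
  (LabelledDiagram.endsOn (ctxChord x y) ((List.finRange y.length).map Sum.inr) i).map Sum.inl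

/-- The legs on the strand `i` connected to the internal vertex. -/
def middle (i : Fin n) : List (TriEnds x y) :=
  ((List.finRange 3).filter fun r => σ r = i).map fun r => .inr (r, false)

variable {x y σ}

theorem mem_before (i : Fin n) (h : TriEnds x y) :
    h ∈ before x y i ↔ ∃ p, h = .inl p ∧ p.1.1.isLeft ∧ p.1.2 = i := by
  simp only [before, List.mem_map, LabelledDiagram.mem_endsOn, List.mem_finRange, true_and]
  constructor
  · rintro ⟨p, ⟨⟨k, hk⟩, hi⟩, rfl⟩
    exact ⟨p, rfl, by rw [← hk]; rfl, hi⟩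
  · rintro ⟨p, rfl, hp, hi⟩
    obtain ⟨k, hk⟩ := Sum.isLeft_iff.1 hp
    exact ⟨p, ⟨⟨k, hk.symm⟩, hi⟩, rfl⟩

theorem mem_after (i : Fin n) (h : TriEnds x y) :
    h ∈ after x y i ↔ ∃ p, h = .inl p ∧ p.1.1.isRight ∧ p.1.2 = i := by
  simp only [after, List.mem_map, LabelledDiagram.mem_endsOn, List.mem_finRange, true_and]
  constructor
  · rintro ⟨p, ⟨⟨k, hk⟩, hi⟩, rfl⟩
    exact ⟨p, rfl, by rw [← hk]; rfl, hi⟩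
  · rintro ⟨p, rfl, hp, hi⟩
    obtain ⟨k, hk⟩ := Sum.isRight_iff.1 hp
    exact ⟨p, ⟨⟨k, hk.symm⟩, hi⟩, rfl⟩

theorem mem_middle (i : Fin n) (h : TriEnds x y) :
    h ∈ middle x y σ i ↔ ∃ r, h = .inr (r, false) ∧ σ r = i := by
  simp only [middle, List.mem_map, List.mem_filter, List.mem_finRange, true_and,
    decide_eq_true_eq]
  exact exists_congr fun r => ⟨fun h => ⟨h.2.symm, h.1⟩, fun h => ⟨h.2, h.1.symm⟩⟩

theorem middle_apply (hσ : Function.Injective σ) (r : Fin 3) :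
    middle x y σ (σ r) = [.inr (r, false)] := by
  simp only [middle, hσ.eq_iff]
  have : (List.finRange 3).filter (fun q => decide (q = r)) = [r] := by decide +revert
  rw [this]
  rfl

theorem middle_eq_nil {i : Fin n} (hi : ∀ r, σ r ≠ i) : middle x y σ i = [] := by
  simp [middle, hi]

theorem mem_legs (i : Fin n) (h : TriEnds x y) :
    h ∈ before x y i ++ middle x y σ i ++ after x y i ↔
      (∃ p, h = .inl p ∧ p.1.2 = i) ∨ ∃ r, h = .inr (r, false) ∧ σ r = i := by
  simp only [List.mem_append, mem_before, mem_middle, mem_after]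
  constructor
  · rintro ((⟨p, h1, -, h2⟩ | h) | ⟨p, h1, -, h2⟩)
    exacts [Or.inl ⟨p, h1, h2⟩, Or.inr h, Or.inl ⟨p, h1, h2⟩]
  · rintro (⟨p, h1, h2⟩ | h)
    · rcases hk : p.1.1 with k | k
      · exact Or.inl (Or.inl ⟨p, h1, by rw [hk]; rfl, h2⟩)
      · exact Or.inr ⟨p, h1, by rw [hk]; rfl, h2⟩
    · exact Or.inl (Or.inr h)

theorem nodup_legs (i : Fin n) : (before x y i ++ middle x y σ i ++ after x y i).Nodup := by
  refine List.Nodup.append (List.Nodup.append ?_ ?_ ?_) ?_ ?_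
  · exact (LabelledDiagram.nodup_endsOn _ _
      ((List.nodup_finRange _).map Sum.inl_injective) i).map Sum.inl_injective
  · refine ((List.nodup_finRange 3).filter _).map fun a b h => ?_
    simpa using h
  · intro h h1 h2
    obtain ⟨p, rfl, -⟩ := (mem_before i h).1 h1
    obtain ⟨r, hr, -⟩ := (mem_middle i _).1 h2
    simp at hr
  · exact (LabelledDiagram.nodup_endsOn _ _
      ((List.nodup_finRange _).map Sum.inr_injective) i).map Sum.inl_injective
  · intro h h1 h2
    obtain ⟨p, rfl, hp, -⟩ := (mem_after i h).1 h2
    rcases List.mem_append.1 h1 with h1 | h1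
    · obtain ⟨q, hq, hq', -⟩ := (mem_before i _).1 h1
      rw [← Sum.inl_injective hq] at hq'
      rcases hk : p.1.1 with k | k <;> simp [hk] at hp hq'
    · obtain ⟨r, hr, -⟩ := (mem_middle i _).1 h1
      simp at hr

end TriEnds

/-- The string link diagram consisting of the chords of `x` and `y` and, between them, of one
internal vertex connected to the three strands in the range of `σ`. -/
def triDiagram : SlDiagram n where
  H := TriEnds x y
  finite := inferInstance
  edge := TriEnds.edge
  edge_edge := by
    rintro (p | ⟨r, b⟩)
    · exact congrArg Sum.inl (LabelledDiagram.otherEnd_otherEnd _ p)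
    · simp [TriEnds.edge]
  edge_ne := by
    rintro (p | ⟨r, b⟩) h
    · exact LabelledDiagram.otherEnd_ne _ p (Sum.inl_injective h)
    · simp [TriEnds.edge] at h
  rot := TriEnds.rot
  rot_rot_rot := by
    rintro (p | ⟨r, _ | _⟩)
    · rfl
    · rfl
    · exact congrArg (fun q => Sum.inr (q, true)) (by decide +revert : r + 1 + 1 + 1 = r)
  legs i := TriEnds.before x y i ++ TriEnds.middle x y σ i ++ TriEnds.after x y i
  nodup i := TriEnds.nodup_legs i
  disjoint i j hij h hi hj := by
    rw [TriEnds.mem_legs] at hi hj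
    rcases hi with ⟨p, rfl, hp⟩ | ⟨r, rfl, hr⟩ <;> rcases hj with ⟨q, hq, hq'⟩ | ⟨s, hs, hs'⟩
    · rw [← Sum.inl_injective hq] at hq'
      exact hij (hp.symm.trans hq')
    · simp at hs
    · simp at hq
    · simp only [Sum.inr.injEq, Prod.mk.injEq, and_true] at hs
      subst hs
      exact hij (hr.symm.trans hs')
  rot_eq_iff h := by
    simp only [TriEnds.mem_legs]
    rcases h with p | ⟨r, _ | _⟩
    · simp [TriEnds.rot]
    · simp [TriEnds.rot]
    · simp [TriEnds.rot]
  connected h := by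
    simp only [TriEnds.mem_legs]
    rcases h with p | ⟨r, _ | _⟩
    · exact ⟨p.1.2, .inl p, Or.inl ⟨p, rfl, rfl⟩, Relation.ReflTransGen.refl⟩
    · exact ⟨σ r, .inr (r, false), Or.inr ⟨r, rfl, rfl⟩, Relation.ReflTransGen.refl⟩
    · exact ⟨σ r, .inr (r, false), Or.inr ⟨r, rfl, rfl⟩, Relation.ReflTransGen.single (Or.inl rfl)⟩

end Context

section Context

variable {n : ℕ} (x y : PbDiagram n) {σ : Fin 3 → Fin n}

/-! ### The four-term relation -/

/-- The difference between the two other indices in `Fin 3` and a given one: the chord `true` is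
to join the strand `σ r` to `σ (r + 1)`, and the chord `false` to `σ (r + 2)`. -/
def shift (b : Bool) : Fin 3 := if b then 1 else 2

theorem add_shift_ne (r : Fin 3) (b : Bool) : r ≠ r + shift b := by
  decide +revert

theorem add_shift_ne_not (r : Fin 3) (b : Bool) : r + shift b ≠ r + shift (!b) := by
  decide +revert

theorem eq_or_eq_add_shift (r q : Fin 3) : q = r ∨ ∃ b, q = r + shift b := by
  decide +revert

theorem add_shift_injective (r : Fin 3) : Function.Injective fun b => r + shift b := by
  unfold Function.Injective
  decide +revert

/-- The two chords joining the strand `σ r` to the two other strands in the range of `σ`. -/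
def forkChord (hσ : Function.Injective σ) (r : Fin 3) (b : Bool) : Chord n :=
  chord (σ r) (σ (r + shift b)) (hσ.ne (add_shift_ne r b))

theorem mem_forkChord (hσ : Function.Injective σ) (r : Fin 3) (b : Bool) (i : Fin n) :
    i ∈ (forkChord hσ r b).1 ↔ i = σ r ∨ i = σ (r + shift b) :=
  Sym2.mem_iff

/-- The ends of the chords in a resolution of `triDiagram` at its leg on `σ r`, as half-edges of
that diagram. The end of the chord `b` on `σ r` was at the internal vertex before, and its other
end was a leg of `triDiagram` already. -/
def resolveEnds (hσ : Function.Injective σ) (r : Fin 3) :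
    LabelledDiagram.Ends (Sum.elim (ctxChord x y) (forkChord hσ r)) → TriEnds x y
  | ⟨(.inl k, i), h⟩ => .inl ⟨(k, i), h⟩
  | ⟨(.inr b, i), _⟩ => .inr (r + shift b, decide (i = σ r))

variable {x y}

theorem resolveEnds_injective (hσ : Function.Injective σ) (r : Fin 3) :
    Function.Injective (resolveEnds x y hσ r) := by
  rintro ⟨⟨k | b, i⟩, h⟩ ⟨⟨k' | b', i'⟩, h'⟩ e
  · have e' := congrArg Subtype.val (Sum.inl_injective e)
    exact Subtype.ext (Prod.ext (congrArg (fun q => Sum.inl q.1) e') (congrArg (fun q => q.2) e'))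
  · simp [resolveEnds] at e
  · simp [resolveEnds] at e
  · simp only [resolveEnds, Sum.inr.injEq, Prod.mk.injEq, decide_eq_decide] at e
    obtain rfl := add_shift_injective r e.1
    have h1 := (mem_forkChord hσ r b i).1 h
    have h2 := (mem_forkChord hσ r b i').1 h'
    have : i = i' := by
      rcases h1 with h1 | h1
      · rw [h1, e.2.1 h1]
      · have h3 : i ≠ σ r := h1.trans_ne (hσ.ne (add_shift_ne r b).symm)
        rw [h1, h2.resolve_left fun h4 => h3 (e.2.2 h4)]
    subst this
    rfl

theorem range_resolveEnds (hσ : Function.Injective σ) (r : Fin 3) :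
    Set.range (resolveEnds x y hσ r) = {h | h ≠ .inr (r, false) ∧ h ≠ .inr (r, true)} := by
  ext h
  constructor
  · rintro ⟨⟨⟨k | b, i⟩, h⟩, rfl⟩
    · exact ⟨Sum.inl_ne_inr, Sum.inl_ne_inr⟩
    · have := (add_shift_ne r b).symm
      exact ⟨fun e => this (congrArg Prod.fst (Sum.inr_injective e)),
        fun e => this (congrArg Prod.fst (Sum.inr_injective e))⟩
  · rintro ⟨h1, h2⟩
    rcases h with ⟨⟨k, i⟩, h⟩ | ⟨q, c⟩
    · exact ⟨⟨(.inl k, i), h⟩, rfl⟩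
    · rcases eq_or_eq_add_shift r q with rfl | ⟨b, rfl⟩
      · cases c
        exacts [absurd rfl h1, absurd rfl h2]
      · cases c
        · refine ⟨⟨(.inr b, σ (r + shift b)), (mem_forkChord hσ r b _).2 (Or.inr rfl)⟩, ?_⟩
          simp [resolveEnds, hσ.eq_iff, (add_shift_ne r b).symm]
        · refine ⟨⟨(.inr b, σ r), (mem_forkChord hσ r b _).2 (Or.inl rfl)⟩, ?_⟩
          simp [resolveEnds]

theorem resolveEnds_otherEnd (hσ : Function.Injective σ) (r : Fin 3)
    (h : LabelledDiagram.Ends (Sum.elim (ctxChord x y) (forkChord hσ r))) :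
    resolveEnds x y hσ r (LabelledDiagram.otherEnd _ h) =
      TriEnds.edge (resolveEnds x y hσ r h) := by
  obtain ⟨⟨k | b, i⟩, h⟩ := h
  · rfl
  · have h1 : Sym2.Mem.other h ≠ i := Sym2.other_ne (forkChord hσ r b).2 h
    have h2 := (mem_forkChord hσ r b _).1 (Sym2.other_mem h)
    have h3 := (mem_forkChord hσ r b i).1 h
    show Sum.inr (r + shift b, decide (Sym2.Mem.other h = σ r)) =
      Sum.inr (r + shift b, !decide (i = σ r))
    congr 2
    rw [← decide_not, decide_eq_decide]
    constructor
    · intro e e'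
      exact h1 (e.trans e'.symm)
    · intro e
      refine h2.resolve_right fun e' => h1 (e'.trans ?_)
      exact (h3.resolve_left e).symm

theorem map_resolveEnds_inl (hσ : Function.Injective σ) (r : Fin 3) {ι : Type*} (l : List ι)
    (g : ι → Ctx x y) (i : Fin n) :
    (LabelledDiagram.endsOn (Sum.elim (ctxChord x y) (forkChord hσ r))
      (l.map (Sum.inl ∘ g)) i).map (resolveEnds x y hσ r) =
    (LabelledDiagram.endsOn (ctxChord x y) (l.map g) i).map Sum.inl := by
  simp only [LabelledDiagram.endsOn, List.filterMap_map, List.map_filterMap]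
  congr 1
  funext k
  by_cases h : i ∈ (ctxChord x y (g k)).1
  · have h' : i ∈ (Sum.elim (ctxChord x y) (forkChord hσ r) (.inl (g k))).1 := h
    simp only [Function.comp_apply, dif_pos h, dif_pos h']
    rfl
  · have h' : i ∉ (Sum.elim (ctxChord x y) (forkChord hσ r) (.inl (g k))).1 := h
    simp only [Function.comp_apply, dif_neg h, dif_neg h']
    rfl

/-- The legs of a resolution of `triDiagram`. -/
theorem map_resolveEnds_legs (hσ : Function.Injective σ) (r : Fin 3) (b : Bool) (i : Fin n) :
    ((ctxDiagram x y (forkChord hσ r) b).toSl.legs i).map (resolveEnds x y hσ r) =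
      TriEnds.before x y i ++
        (LabelledDiagram.endsOn (Sum.elim (ctxChord x y) (forkChord hσ r))
          [.inr b, .inr !b] i).map (resolveEnds x y hσ r) ++ TriEnds.after x y i := by
  show (LabelledDiagram.endsOn (Sum.elim (ctxChord x y) (forkChord hσ r)) (_ ++ _ ++ _) i).map
    (resolveEnds x y hσ r) = _
  rw [LabelledDiagram.endsOn_append, LabelledDiagram.endsOn_append, List.map_append,
    List.map_append, map_resolveEnds_inl, map_resolveEnds_inl]
  rfl

theorem map_resolveEnds_self (hσ : Function.Injective σ) (r : Fin 3) (b : Bool) :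
    (LabelledDiagram.endsOn (Sum.elim (ctxChord x y) (forkChord hσ r))
      [.inr b, .inr !b] (σ r)).map (resolveEnds x y hσ r) =
      [.inr (r + shift b, true), .inr (r + shift !b, true)] := by
  have h : ∀ c, σ r ∈ (Sum.elim (ctxChord x y) (forkChord hσ r) (.inr c)).1 := fun c =>
    (mem_forkChord hσ r c _).2 (Or.inl rfl)
  rw [LabelledDiagram.endsOn_cons_pos _ _ _ (h b), LabelledDiagram.endsOn_cons_pos _ _ _ (h !b)]
  simp [resolveEnds, LabelledDiagram.endsOn_nil]

theorem map_resolveEnds_of_ne (hσ : Function.Injective σ) (r : Fin 3) (b : Bool) {i : Fin n}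
    (hi : i ≠ σ r) :
    (LabelledDiagram.endsOn (Sum.elim (ctxChord x y) (forkChord hσ r))
      [.inr b, .inr !b] i).map (resolveEnds x y hσ r) = TriEnds.middle x y σ i := by
  have hiff : ∀ c, i ∈ (Sum.elim (ctxChord x y) (forkChord hσ r) (.inr c)).1 ↔
      i = σ (r + shift c) := fun c =>
    (mem_forkChord hσ r c _).trans (or_iff_right hi)
  by_cases h1 : i = σ (r + shift b)
  · have h2 : i ≠ σ (r + shift !b) := h1.trans_ne (hσ.ne (add_shift_ne_not r b))
    rw [LabelledDiagram.endsOn_cons_pos _ _ _ ((hiff b).2 h1),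
      LabelledDiagram.endsOn_cons_neg _ _ _ (fun h => h2 ((hiff !b).1 h)),
      LabelledDiagram.endsOn_nil]
    conv_rhs => rw [h1, TriEnds.middle_apply hσ]
    simp [resolveEnds, hi]
  · rw [LabelledDiagram.endsOn_cons_neg _ _ _ (fun h => h1 ((hiff b).1 h))]
    by_cases h2 : i = σ (r + shift !b)
    · rw [LabelledDiagram.endsOn_cons_pos _ _ _ ((hiff !b).2 h2), LabelledDiagram.endsOn_nil]
      conv_rhs => rw [h2, TriEnds.middle_apply hσ]
      simp [resolveEnds, hi]
    · rw [LabelledDiagram.endsOn_cons_neg _ _ _ (fun h => h2 ((hiff !b).1 h)),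
        LabelledDiagram.endsOn_nil, TriEnds.middle_eq_nil]
      · rfl
      · intro q hq
        rcases eq_or_eq_add_shift r q with rfl | ⟨c, rfl⟩
        · exact hi hq.symm
        · cases b <;> cases c
          exacts [h1 hq.symm, h2 hq.symm, h2 hq.symm, h1 hq.symm]

theorem isResolution_triDiagram (hσ : Function.Injective σ) (r : Fin 3) (b : Bool) :
    (triDiagram x y σ).IsResolution (ctxDiagram x y (forkChord hσ r) b).toSl
      (.inr (r, false)) (.inr (r, true)) (σ r)
      (TriEnds.before x y (σ r) ++ [.inr (r + shift b, true), .inr (r + shift !b, true)] ++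
        TriEnds.after x y (σ r)) := by
  refine ⟨resolveEnds x y hσ r, resolveEnds_injective hσ r, range_resolveEnds hσ r,
    resolveEnds_otherEnd hσ r, fun h hh => absurd rfl hh, ?_, fun j hj => ?_⟩
  · refine (map_resolveEnds_legs hσ r b (σ r)).trans ?_
    rw [map_resolveEnds_self]
    rfl
  · refine (map_resolveEnds_legs hσ r b j).trans ?_
    rw [map_resolveEnds_of_ne hσ r b hj]
    rfl

/-- The `STU` relation at each of the three legs of `triDiagram`. -/
theorem isSTU_triDiagram (hσ : Function.Injective σ) (r : Fin 3) :
    (triDiagram x y σ).IsSTU (ctxDiagram x y (forkChord hσ r) false).toSl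
      (ctxDiagram x y (forkChord hσ r) true).toSl := by
  have h2 : r + 1 + 1 = r + 2 := by decide +revert
  refine ⟨σ r, .inr (r, false), .inr (r, true), TriEnds.before x y (σ r),
    TriEnds.after x y (σ r), rfl, ?_, ?_, ?_, ?_⟩
  · intro h
    exact absurd (congrArg Prod.fst (Sum.inr_injective h)) (add_shift_ne r true).symm
  · show _ ++ TriEnds.middle x y σ (σ r) ++ _ = _
    rw [TriEnds.middle_apply hσ]
    rfl
  · have := isResolution_triDiagram (x := x) (y := y) hσ r false
    rw [show r + shift false = r + 1 + 1 from h2.symm] at this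
    exact this
  · have := isResolution_triDiagram (x := x) (y := y) hσ r true
    rw [show r + shift (!true) = r + 1 + 1 from h2.symm] at this
    exact this

theorem mk_eq_sub_of_isSTU (K : Type*) [CommRing K] {S T U : SlDiagram n} (h : S.IsSTU T U) :
    Asl.mk K S = Asl.mk K T - Asl.mk K U := by
  rw [Asl.mk, Asl.mk, Asl.mk, ← map_sub, ← sub_eq_zero, ← map_sub, Submodule.mkQ_apply,
    Submodule.Quotient.mk_eq_zero]
  exact Submodule.subset_span ⟨S, T, U, h, rfl⟩

/-- The diagram with one internal vertex is, for each of its legs, a commutator of two chords. -/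
theorem mk_triDiagram (K : Type*) [CommRing K] (hσ : Function.Injective σ) (r : Fin 3) :
    Asl.mk K (triDiagram x y σ) =
      Asl.mk K (PbDiagram.toSl (x ++ [forkChord hσ r false, forkChord hσ r true] ++ y)) -
        Asl.mk K (PbDiagram.toSl (x ++ [forkChord hσ r true, forkChord hσ r false] ++ y)) := by
  rw [mk_eq_sub_of_isSTU K (isSTU_triDiagram hσ r),
    (ctxDiagram x y (forkChord hσ r) false).mk_toSl K (ctxDiagram_map x y _ false),
    (ctxDiagram x y (forkChord hσ r) true).mk_toSl K (ctxDiagram_map x y _ true)]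
  rfl

theorem mk_toSl_fourT (K : Type*) [CommRing K] (x y : PbDiagram n) (i j k : Fin n)
    (hij : i ≠ j) (hik : i ≠ k) (hjk : j ≠ k) :
    Asl.mk K (PbDiagram.toSl (x ++ [chord i k hik, chord i j hij] ++ y)) +
        Asl.mk K (PbDiagram.toSl (x ++ [chord j k hjk, chord i j hij] ++ y)) =
      Asl.mk K (PbDiagram.toSl (x ++ [chord i j hij, chord i k hik] ++ y)) +
        Asl.mk K (PbDiagram.toSl (x ++ [chord i j hij, chord j k hjk] ++ y)) := by
  let σ : Fin 3 → Fin n := ![i, j, k]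
  have hσ : Function.Injective σ := by
    intro a b
    fin_cases a <;> fin_cases b <;> simp [σ, hij, hik, hjk, hij.symm, hik.symm, hjk.symm]
  have h0 := mk_triDiagram (x := x) (y := y) K hσ 0
  have h1 := mk_triDiagram (x := x) (y := y) K hσ 1
  have e1 : forkChord hσ 0 false = chord i k hik := rfl
  have e2 : forkChord hσ 0 true = chord i j hij := rfl
  have e3 : forkChord hσ 1 false = chord i j hij := Subtype.ext Sym2.eq_swap
  have e4 : forkChord hσ 1 true = chord j k hjk := rfl
  rw [e1, e2] at h0
  rw [e3, e4] at h1
  have := h0.symm.trans h1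
  rw [sub_eq_sub_iff_add_eq_add] at this
  rw [this, add_comm]

end Context

/-! ### The map from `A^{pb}` to `A^{sl}` -/

section Hom

variable (K : Type*) [CommRing K] (n : ℕ)

/-- The linear map sending a chord diagram to the class of the corresponding string link
diagram. -/
def dpbHom : Dpb K n →ₗ[K] Asl K n :=
  (FreeAlgebra.basisFreeMonoid K (Chord n)).constr K fun w =>
    Asl.mk K (PbDiagram.toSl (FreeMonoid.toList w))

variable {K n}

theorem basisFreeMonoid_apply (w : PbDiagram n) :
    FreeAlgebra.basisFreeMonoid K (Chord n) (FreeMonoid.ofList w) =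
      (w.map (FreeAlgebra.ι K)).prod := by
  simp [FreeAlgebra.basisFreeMonoid, FreeAlgebra.equivMonoidAlgebraFreeMonoid, FreeMonoid.lift_apply]

theorem dpbHom_word (w : PbDiagram n) :
    dpbHom K n (w.map (FreeAlgebra.ι K)).prod = Asl.mk K (PbDiagram.toSl w) := by
  rw [← basisFreeMonoid_apply, dpbHom, Module.Basis.constr_basis]
  rfl

theorem mem_span_words (u : Dpb K n) : u ∈ Submodule.span K
    (Set.range fun w : PbDiagram n => (w.map (FreeAlgebra.ι K)).prod) := by
  refine Submodule.span_mono ?_ ((FreeAlgebra.basisFreeMonoid K (Chord n)).mem_span u)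
  rintro _ ⟨w, rfl⟩
  exact ⟨FreeMonoid.toList w, (basisFreeMonoid_apply _).symm⟩

theorem dpbHom_rel {a b : Dpb K n} (h : PbRel K n a b) (u v : Dpb K n) :
    dpbHom K n (u * a * v) = dpbHom K n (u * b * v) := by
  have hu := mem_span_words u
  have hv := mem_span_words v
  induction hu using Submodule.span_induction with
  | zero => simp
  | add p q _ _ hp hq => simp only [add_mul, map_add, hp, hq]
  | smul c p _ hp => simp only [smul_mul_assoc, map_smul, hp]
  | mem p hp =>
  obtain ⟨x, rfl⟩ := hp
  induction hv using Submodule.span_induction with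
  | zero => simp
  | add p q _ _ hp hq => simp only [mul_add, map_add, hp, hq]
  | smul c p _ hp => simp only [mul_smul_comm, map_smul, hp]
  | mem p hp =>
  obtain ⟨y, rfl⟩ := hp
  have hw : ∀ c c' : Chord n, (x.map (FreeAlgebra.ι K)).prod *
      (FreeAlgebra.ι K c * FreeAlgebra.ι K c') * (y.map (FreeAlgebra.ι K)).prod =
      ((x ++ [c, c'] ++ y).map (FreeAlgebra.ι K)).prod := by
    intro c c'
    simp [mul_assoc]
  cases h with
  | comm i j k l hij hkl hik hil hjk hjl =>
    simp only [t, hw, dpbHom_word]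
    refine mk_toSl_comm x y K _ _ fun m hm hm' => ?_
    rcases Sym2.mem_iff.1 hm with rfl | rfl <;> rcases Sym2.mem_iff.1 hm' with h | h
    exacts [hik h, hil h, hjk h, hjl h]
  | fourT i j k hij hik hjk =>
    simp only [add_mul, mul_add, t, hw, dpbHom_word, map_add]
    exact mk_toSl_fourT K x y i j k hij hik hjk

/-- The linear map `dpbHom` vanishes on the ideal generated by the relations, and therefore
descends to `A^{pb}`. -/
theorem dpbHom_eq_zero {a : Dpb K n} (h : RingQuot.mkAlgHom K (PbRel K n) a = 0) :
    dpbHom K n a = 0 := by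
  -- the largest two-sided ideal in the kernel of `dpbHom`
  let c : RingCon (Dpb K n) :=
    { r := fun a b => ∀ u v, dpbHom K n (u * a * v) = dpbHom K n (u * b * v)
      iseqv := ⟨fun _ _ _ => rfl, fun h u v => (h u v).symm,
        fun h h' u v => (h u v).trans (h' u v)⟩
      add' := fun h h' u v => by
        simp only [mul_add, add_mul, map_add, h u v, h' u v]
      mul' := fun {a b a' b'} h h' u v => by
        rw [← mul_assoc, mul_assoc (u * a), h u (a' * v), ← mul_assoc u b b', ← h' (u * b) v]
        simp only [mul_assoc] }
  have key : RingQuot.lift ⟨c.mk', fun a b h => (RingCon.eq c).2 (dpbHom_rel h)⟩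
      (RingQuot.mkRingHom (PbRel K n) a) = c.mk' a := RingQuot.lift_mkRingHom_apply _ _ _
  rw [← RingQuot.mkAlgHom_coe K, RingHom.coe_coe, h, map_zero] at key
  have := (RingCon.eq c).1 (key.symm.trans (map_zero c.mk').symm) 1 1
  simpa using this

variable (K n)

/-- The map from `A^{pb}` to `A^{sl}`. -/
def apbHom : Apb K n →ₗ[K] Asl K n :=
  ((RingQuot.mkAlgHom K (PbRel K n)).toLinearMap.ker.liftQ (dpbHom K n) fun _ h =>
    dpbHom_eq_zero h) ∘ₗ
  ((RingQuot.mkAlgHom K (PbRel K n)).toLinearMap.quotKerEquivOfSurjective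
    (RingQuot.mkAlgHom_surjective K _)).symm.toLinearMap

variable {K n}

theorem apbHom_mk (w : PbDiagram n) : apbHom K n (Apb.mk K w) = Asl.mk K (PbDiagram.toSl w) := by
  have : ((RingQuot.mkAlgHom K (PbRel K n)).toLinearMap.quotKerEquivOfSurjective
    (RingQuot.mkAlgHom_surjective K _)).symm (Apb.mk K w) =
      Submodule.Quotient.mk (w.map (FreeAlgebra.ι K)).prod := by
    rw [LinearEquiv.symm_apply_eq]
    rfl
  rw [apbHom, LinearMap.comp_apply, LinearEquiv.coe_coe, this]
  exact dpbHom_word w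

end Hom

/-! ### Sorted chord diagrams span `A^{pb}` -/

section Sorted

variable {n : ℕ}

/-- A chord diagram is sorted if the last strands of its chords increase weakly. -/
def Sorted (w : PbDiagram n) : Prop := w.Pairwise fun c c' => c.hi ≤ c'.hi

theorem exists_descent (w : PbDiagram n) (h : ¬ Sorted w) :
    ∃ (x y : PbDiagram n) (c c' : Chord n), w = x ++ [c, c'] ++ y ∧ c'.hi < c.hi := by
  induction w with
  | nil => exact absurd List.Pairwise.nil h
  | cons c w ih =>
    by_cases hw : Sorted w
    · cases w with
      | nil => exact absurd (List.pairwise_singleton _ _) h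
      | cons c' w =>
        refine ⟨[], w, c, c', rfl, lt_of_not_ge fun hle => h ?_⟩
        refine List.pairwise_cons.2 ⟨fun d hd => ?_, hw⟩
        rcases List.mem_cons.1 hd with rfl | hd
        exacts [hle, hle.trans ((List.pairwise_cons.1 hw).1 d hd)]
    · obtain ⟨x, y, d, d', rfl, hd⟩ := ih hw
      exact ⟨c :: x, y, d, d', rfl, hd⟩

/-- The sum over the chords of the number of strands from their last strand onwards. -/
def total (w : PbDiagram n) : ℕ := (w.map fun c => n - c.hi.val).sum

/-- The sum of the totals of all tails of a chord diagram: it drops when a chord is moved to the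
front past a chord with a higher last strand, and when the last strand of a chord is raised. -/
def cost : PbDiagram n → ℕ
  | [] => 0
  | c :: w => total (c :: w) + cost w

theorem cost_append_lt (x w w' : PbDiagram n) (h : total w ≤ total w') (hc : cost w < cost w') :
    cost (x ++ w) < cost (x ++ w') := by
  induction x with
  | nil => exact hc
  | cons c x ih =>
    have : total (c :: (x ++ w)) ≤ total (c :: (x ++ w')) := by
      simp only [total, List.map_cons, List.map_append, List.sum_cons, List.sum_append] at h ⊢
      omega
    simp only [List.cons_append, cost]
    omega

theorem cost_lt (x y : PbDiagram n) {c c' p q : Chord n} (h : c'.hi < c.hi)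
    (hpq : (p = c' ∧ q = c) ∨ (p.hi = c.hi ∧ q.hi = c.hi)) :
    cost (x ++ [p, q] ++ y) < cost (x ++ [c, c'] ++ y) := by
  have h' : c'.hi.val < c.hi.val := h
  have hn := c.hi.isLt
  rw [List.append_assoc, List.append_assoc]
  refine cost_append_lt x _ _ ?_ ?_
  · rcases hpq with ⟨rfl, rfl⟩ | ⟨hp, hq⟩
    · simp [total]
      omega
    · simp [total, hp, hq]
      omega
  · rcases hpq with ⟨rfl, rfl⟩ | ⟨hp, hq⟩
    · simp [cost, total]
      omega
    · simp [cost, total, hp, hq]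
      omega

variable (K : Type*) [CommRing K]

/-- The class in `A^{pb}` of a chord. -/
def chordClass (c : Chord n) : Apb K n := RingQuot.mkAlgHom K (PbRel K n) (FreeAlgebra.ι K c)

variable {K}

theorem apb_mk_eq (w : PbDiagram n) : Apb.mk K w = (w.map (chordClass K)).prod := by
  rw [Apb.mk, map_list_prod, List.map_map]
  rfl

/-- The rewriting rule for a chord followed by a chord with a lower last strand. -/
theorem chordClass_mul_mem {c c' : Chord n} (h : c'.hi < c.hi) :
    chordClass K c * chordClass K c' ∈ Submodule.span K
      {a | ∃ p q : Chord n, ((p = c' ∧ q = c) ∨ (p.hi = c.hi ∧ q.hi = c.hi)) ∧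
        a = chordClass K p * chordClass K q} := by
  have hc := c.lo_lt_hi
  have hc' := c'.lo_lt_hi
  have key : ∀ i' : Fin n, i' < c.hi → (hi : c.lo ≠ i') → c' = chord c.lo i' hi →
      chordClass K c * chordClass K c' ∈ Submodule.span K
      {a | ∃ p q : Chord n, ((p = c' ∧ q = c) ∨ (p.hi = c.hi ∧ q.hi = c.hi)) ∧
        a = chordClass K p * chordClass K q} := by
    intro i' hlt hi heq
    -- `[t^{lo,i'} + t^{hi,i'}, t^{lo,hi}] = 0`, where both terms with `t^{hi,i'}` have the same
    -- last strand `c.hi` in both chords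
    have rel := RingQuot.mkAlgHom_rel K (PbRel.fourT (K := K) c.lo c.hi i' hc.ne hi hlt.ne')
    simp only [map_mul, map_add, add_mul, mul_add, t] at rel
    rw [← c.eq_chord, ← heq] at rel
    set d := chord c.hi i' hlt.ne' with hd
    have hdh : d.hi = c.hi := by
      show max c.hi i' = c.hi
      exact max_eq_left hlt.le
    have e : chordClass K c * chordClass K c' = chordClass K c' * chordClass K c +
        chordClass K d * chordClass K c - chordClass K c * chordClass K d := by
      rw [eq_sub_iff_add_eq]
      exact rel.symm
    rw [e]
    refine Submodule.sub_mem _ (Submodule.add_mem _ ?_ ?_) ?_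
    · exact Submodule.subset_span ⟨_, _, Or.inl ⟨rfl, rfl⟩, rfl⟩
    · exact Submodule.subset_span ⟨_, _, Or.inr ⟨hdh, rfl⟩, rfl⟩
    · exact Submodule.subset_span ⟨_, _, Or.inr ⟨rfl, hdh⟩, rfl⟩
  by_cases h1 : c.lo = c'.lo
  · exact key c'.hi h (h1.trans_ne hc'.ne) (Chord.ext (by
      show _ = min c.lo c'.hi
      rw [h1, min_eq_left hc'.le]) (by
      show _ = max c.lo c'.hi
      rw [h1, max_eq_right hc'.le]))
  by_cases h2 : c.lo = c'.hi
  · exact key c'.lo (hc'.trans h) (h2.trans_ne hc'.ne') (Chord.ext (by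
      show _ = min c.lo c'.lo
      rw [h2, min_eq_right hc'.le]) (by
      show _ = max c.lo c'.lo
      rw [h2, max_eq_left hc'.le]))
  have rel := RingQuot.mkAlgHom_rel K (PbRel.comm (K := K) c.lo c.hi c'.lo c'.hi hc.ne hc'.ne
    h1 h2 (hc'.trans h).ne' h.ne')
  simp only [map_mul, t] at rel
  rw [← c.eq_chord, ← c'.eq_chord] at rel
  exact Submodule.subset_span ⟨_, _, Or.inl ⟨rfl, rfl⟩, rel⟩

/-- A descent is removed by the rewriting rule, which lowers `cost` in each of the terms. -/
theorem apb_mk_mem_span_sorted (w : PbDiagram n) :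
    Apb.mk K w ∈ Submodule.span K (Apb.mk K '' {w : PbDiagram n | Sorted w}) := by
  induction hN : cost w using Nat.strong_induction_on generalizing w with
  | _ N ih =>
  by_cases hw : Sorted w
  · exact Submodule.subset_span ⟨w, hw, rfl⟩
  obtain ⟨x, y, c, c', rfl, h⟩ := exists_descent w hw
  have e : ∀ p q : Chord n, Apb.mk K (x ++ [p, q] ++ y) =
      (LinearMap.mulLeft K (Apb.mk K x) ∘ₗ LinearMap.mulRight K (Apb.mk K y))
        (chordClass K p * chordClass K q) := by
    intro p q
    simp [apb_mk_eq, mul_assoc]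
  rw [e]
  have := Submodule.mem_map_of_mem (f := LinearMap.mulLeft K (Apb.mk K x) ∘ₗ
    LinearMap.mulRight K (Apb.mk K y)) (chordClass_mul_mem (K := K) h)
  rw [Submodule.map_span] at this
  refine Submodule.span_le.2 ?_ this
  rintro _ ⟨_, ⟨p, q, hpq, rfl⟩, rfl⟩
  rw [← e]
  exact ih _ (hN ▸ cost_lt x y h hpq) _ rfl

/-- Every element of `A^{pb}` is a linear combination of sorted chord diagrams. -/
theorem mem_span_sorted (a : Apb K n) :
    a ∈ Submodule.span K (Apb.mk K '' {w : PbDiagram n | Sorted w}) := by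
  obtain ⟨b, rfl⟩ := RingQuot.mkAlgHom_surjective K (PbRel K n) a
  have := Submodule.mem_map_of_mem (f := (RingQuot.mkAlgHom K (PbRel K n)).toLinearMap)
    (mem_span_words b)
  rw [Submodule.map_span] at this
  refine Submodule.span_le.2 ?_ this
  rintro _ ⟨_, ⟨w, rfl⟩, rfl⟩
  exact apb_mk_mem_span_sorted w

/-- For each strand `j`, the list of the first strands of the chords whose last strand is `j`, in
the reverse order. -/
def partners : PbDiagram n → Fin n → List (Fin n)
  | [] => fun _ => []
  | c :: w => Function.update (partners w) c.hi (partners w c.hi ++ [c.lo])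

theorem partners_lt (w : PbDiagram n) (j : Fin n) : ∀ i ∈ partners w j, i < j := by
  induction w with
  | nil => simp [partners]
  | cons c w ih =>
    intro i hi
    by_cases h : j = c.hi
    · subst h
      rw [partners, Function.update_self, List.mem_append, List.mem_singleton] at hi
      rcases hi with hi | rfl
      exacts [ih i hi, c.lo_lt_hi]
    · rw [partners, Function.update_of_ne h] at hi
      exact ih i hi

theorem partners_eq_nil (w : PbDiagram n) (j : Fin n) (h : ∀ c ∈ w, c.hi ≠ j) :
    partners w j = [] := by
  induction w with
  | nil => rfl
  | cons c w ih =>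
    rw [partners, Function.update_of_ne (h c (by simp)).symm]
    exact ih fun d hd => h d (by simp [hd])

theorem partners_cons_ne_nil (c : Chord n) (w : PbDiagram n) :
    partners (c :: w) c.hi ≠ [] := by
  simp [partners]

/-- A sorted chord diagram can be recovered from the partners. -/
theorem partners_injOn {w w' : PbDiagram n} (hw : Sorted w) (hw' : Sorted w')
    (h : partners w = partners w') : w = w' := by
  induction w generalizing w' with
  | nil =>
    cases w' with
    | nil => rfl
    | cons c w' => exact absurd (congrFun h c.hi).symm (partners_cons_ne_nil c w')
  | cons c w ih =>
    cases w' with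
    | nil => exact absurd (congrFun h c.hi) (partners_cons_ne_nil c w)
    | cons c' w' =>
      rw [Sorted, List.pairwise_cons] at hw hw'
      have aux : ∀ (c c' : Chord n) (w w' : PbDiagram n), (∀ d ∈ w', c'.hi ≤ d.hi) →
          partners (c :: w) = partners (c' :: w') → ¬ c.hi < c'.hi := by
        intro c c' w w' hs h hlt
        refine partners_cons_ne_nil c w ?_
        rw [h]
        refine partners_eq_nil _ _ fun d hd => ?_
        rcases List.mem_cons.1 hd with rfl | hd
        exacts [hlt.ne', (hlt.trans_le (hs d hd)).ne']
      have hhi : c.hi = c'.hi := le_antisymm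
        (not_lt.1 (aux c' c w' w hw.1 h.symm)) (not_lt.1 (aux c c' w w' hw'.1 h))
      have h1 := congrFun h c.hi
      rw [partners, partners, Function.update_self, hhi, Function.update_self] at h1
      obtain ⟨h2, h3⟩ := List.append_inj' h1 rfl
      have hcc : c = c' := Chord.ext (by simpa using h3) hhi
      subst hcc
      rw [ih hw.2 hw'.2]
      funext j
      by_cases hj : j = c.hi
      · rw [hj, h2]
      · have := congrFun h j
        rwa [partners, partners, Function.update_of_ne hj, Function.update_of_ne hj] at this

end Sorted

/-! ### The state sum of matrices acting on matrices and vectors -/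

section Matrices

variable (K : Type*) [CommRing K] (n : ℕ) (I : Type)

/-- The polynomials in the entries of an `I × I` matrix and of a vector for each strand. -/
abbrev MatPoly : Type _ := MvPolynomial ((Fin n × I × I) ⊕ (Fin n × I)) K

variable {n I}

/-- The entry `(p, q)` of the matrix on the strand `i`. -/
def matVar (i : Fin n) (p q : I) : MatPoly K n I := MvPolynomial.X (.inl (i, p, q))

/-- The entry `p` of the vector on the strand `i`. -/
def vecVar (i : Fin n) (p : I) : MatPoly K n I := MvPolynomial.X (.inr (i, p))

variable {K} in
theorem derivation_ext_vars {D D' : Derivation K (MatPoly K n I) (MatPoly K n I)}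
    (h1 : ∀ i p q, D (matVar K i p q) = D' (matVar K i p q))
    (h2 : ∀ i p, D (vecVar K i p) = D' (vecVar K i p)) : D = D' := by
  refine MvPolynomial.derivation_ext ?_
  rintro (⟨i, p, q⟩ | ⟨i, p⟩)
  exacts [h1 i p q, h2 i p]

variable [DecidableEq I]

/-- The derivation given by the action of the elementary matrix `E_{ab}` on the matrix (by the
commutator) and on the vector of the strand `i`. -/
def unitDer (i : Fin n) (e : I × I) : Derivation K (MatPoly K n I) (MatPoly K n I) :=
  MvPolynomial.mkDerivation K fun
    | .inl (j, p, q) => if j = i then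
        (if p = e.1 then matVar K j e.2 q else 0) - (if q = e.2 then matVar K j p e.1 else 0)
      else 0
    | .inr (j, p) => if j = i then (if p = e.1 then vecVar K j e.2 else 0) else 0

variable {K}

theorem unitDer_matVar (i j : Fin n) (e : I × I) (p q : I) :
    unitDer K i e (matVar K j p q) = if j = i then
      (if p = e.1 then matVar K j e.2 q else 0) - (if q = e.2 then matVar K j p e.1 else 0)
      else 0 :=
  MvPolynomial.mkDerivation_X ..

theorem unitDer_vecVar (i j : Fin n) (e : I × I) (p : I) :
    unitDer K i e (vecVar K j p) =
      if j = i then (if p = e.1 then vecVar K j e.2 else 0) else 0 :=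
  MvPolynomial.mkDerivation_X ..

theorem derivation_ite_apply {R A : Type*} [CommRing R] [CommRing A] [Algebra R A] (P : Prop)
    [Decidable P] (D : Derivation R A A) (a : A) :
    (if P then D else 0) a = if P then D a else 0 := by
  split_ifs <;> rfl

theorem derivation_sum_apply {ι R A : Type*} [CommRing R] [CommRing A] [Algebra R A]
    (s : Finset ι) (D : ι → Derivation R A A) (a : A) : (∑ i ∈ s, D i) a = ∑ i ∈ s, D i a :=
  map_sum ((Pi.evalAddMonoidHom (fun _ : A => A) a).comp Derivation.coeFnAddMonoidHom) D s

variable (K)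

/-- The coefficient of the elementary matrix `z` in the commutator `[x, y]`. -/
def structConst (x y z : I × I) : K :=
  (if x.2 = y.1 ∧ z = (x.1, y.2) then 1 else 0) - (if y.2 = x.1 ∧ z = (y.1, x.2) then 1 else 0)

variable {K}

theorem structConst_antisymm (x y z : I × I) : structConst K y x z = -structConst K x y z := by
  simp only [structConst, neg_sub]

theorem lie_unitDer_of_ne {i j : Fin n} (hij : i ≠ j) (x y : I × I) :
    ⁅unitDer K i x, unitDer K j y⁆ = 0 := by
  refine derivation_ext_vars (fun k p q => ?_) (fun k p => ?_)
  · simp only [Derivation.commutator_apply, unitDer_matVar, Derivation.zero_apply]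
    by_cases h1 : k = i
    · subst h1
      simp only [if_true, if_neg hij, map_zero, map_sub, apply_ite (unitDer K j y),
        unitDer_matVar]
      simp
    · simp only [if_neg h1, map_zero, sub_zero]
      by_cases h2 : k = j
      · simp only [if_pos h2, map_sub, apply_ite (unitDer K i x), unitDer_matVar, if_neg h1,
          map_zero]
        simp
      · simp [h2]
  · simp only [Derivation.commutator_apply, unitDer_vecVar, Derivation.zero_apply]
    by_cases h1 : k = i
    · subst h1
      simp only [if_true, if_neg hij, map_zero, apply_ite (unitDer K j y), unitDer_vecVar]
      simp
    · simp only [if_neg h1, map_zero, sub_zero]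
      by_cases h2 : k = j
      · simp only [if_pos h2, apply_ite (unitDer K i x), unitDer_vecVar, if_neg h1, map_zero]
        simp
      · simp [h2]

variable [Fintype I]

theorem sum_structConst {M : Type*} [AddCommGroup M] [Module K M] (x y : I × I)
    (F : I × I → M) : ∑ z, structConst K x y z • F z =
      (if x.2 = y.1 then F (x.1, y.2) else 0) - (if y.2 = x.1 then F (y.1, x.2) else 0) := by
  simp only [structConst, sub_smul, ite_smul, one_smul, zero_smul, Finset.sum_sub_distrib]
  congr 1
  · by_cases h : x.2 = y.1 <;> simp [h]
  · by_cases h : y.2 = x.1 <;> simp [h]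

theorem sum_structConst_mid {M : Type*} [AddCommGroup M] [Module K M] (y ξ : I × I)
    (F : I × I → M) : ∑ z, structConst K y z ξ • F z =
      (if ξ.1 = y.1 then F (y.2, ξ.2) else 0) - (if ξ.2 = y.2 then F (ξ.1, y.1) else 0) := by
  have h1 : ∀ z : I × I, (y.2 = z.1 ∧ ξ = (y.1, z.2)) ↔ (ξ.1 = y.1 ∧ z = (y.2, ξ.2)) := by
    rintro ⟨a, b⟩; obtain ⟨c, d⟩ := ξ; simp only [Prod.mk.injEq]; grind
  have h2 : ∀ z : I × I, (z.2 = y.1 ∧ ξ = (z.1, y.2)) ↔ (ξ.2 = y.2 ∧ z = (ξ.1, y.1)) := by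
    rintro ⟨a, b⟩; obtain ⟨c, d⟩ := ξ; simp only [Prod.mk.injEq]; grind
  simp only [structConst, sub_smul, ite_smul, one_smul, zero_smul, Finset.sum_sub_distrib, h1, h2]
  congr 1
  · by_cases h : ξ.1 = y.1 <;> simp [h]
  · by_cases h : ξ.2 = y.2 <;> simp [h]

/-- The derivations form an antirepresentation, because they act on coordinate functions. -/
theorem lie_unitDer (i : Fin n) (x y : I × I) :
    ⁅unitDer K i y, unitDer K i x⁆ = ∑ z, structConst K x y z • unitDer K i z := by
  refine Eq.trans ?_ (sum_structConst (K := K) x y (unitDer K i)).symm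
  obtain ⟨a, b⟩ := x
  obtain ⟨c, d⟩ := y
  refine derivation_ext_vars (fun j p q => ?_) (fun j p => ?_)
  · rw [Derivation.commutator_apply, Derivation.sub_apply, derivation_ite_apply,
      derivation_ite_apply]
    by_cases h : j = i
    · simp only [unitDer_matVar, if_pos h, map_sub, apply_ite (unitDer K i _), map_zero]
      grind
    · simp [unitDer_matVar, h]
  · rw [Derivation.commutator_apply, Derivation.sub_apply, derivation_ite_apply,
      derivation_ite_apply]
    by_cases h : j = i
    · simp only [unitDer_vecVar, if_pos h, apply_ite (unitDer K i _), map_zero]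
      grind
    · simp [unitDer_vecVar, h]

variable (K n I)

/-- The invariant tensor of the Lie algebra of matrices extended by its dual: up to a cyclic
permutation, it is nonzero only on two elementary matrices and one element of the dual basis. -/
def doubleTensor : (I × I) ⊕ (I × I) → (I × I) ⊕ (I × I) → (I × I) ⊕ (I × I) → K
  | .inl x, .inl y, .inr z => structConst K x y z
  | .inr z, .inl x, .inl y => structConst K x y z
  | .inl y, .inr z, .inl x => structConst K x y z
  | _, _, _ => 0

/-- The matrices act by derivations, the dual space by multiplication with matrix entries. -/
def doubleOp (i : Fin n) : (I × I) ⊕ (I × I) → Module.End K (MatPoly K n I)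
  | .inl e => (unitDer K i e : MatPoly K n I →ₗ[K] MatPoly K n I)
  | .inr e => LinearMap.mulLeft K (matVar K i e.1 e.2)

/-- The state sum for the Lie algebra of matrices, extended by its dual space as an abelian
ideal, which acts on the polynomial functions of a matrix and a vector for each strand. -/
def matWeight : WeightData K n ((I × I) ⊕ (I × I)) (Module.End K (MatPoly K n I)) where
  dual := Sum.swap
  dual_dual := Sum.swap_swap
  f := doubleTensor K I
  cyclic := by
    rintro (x | x) (y | y) (z | z) <;> rfl
  ρ := doubleOp K n I
  comm := by
    rintro i j hij (x | x) (y | y)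
    · have := lie_unitDer_of_ne (K := K) hij x y
      refine LinearMap.ext fun a => ?_
      have h := congrArg (fun D => D a) this
      simp only [Derivation.commutator_apply, Derivation.zero_apply] at h
      exact sub_eq_zero.1 h
    · refine LinearMap.ext fun a => ?_
      show unitDer K i x (matVar K j y.1 y.2 * a) = matVar K j y.1 y.2 * unitDer K i x a
      rw [Derivation.leibniz, unitDer_matVar, if_neg hij.symm]
      simp
    · refine LinearMap.ext fun a => ?_
      show matVar K i x.1 x.2 * unitDer K j y a = unitDer K j y (matVar K i x.1 x.2 * a)
      rw [Derivation.leibniz, unitDer_matVar, if_neg hij]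
      simp
    · refine LinearMap.ext fun a => ?_
      exact mul_left_comm _ _ _
  stu := by
    rintro i (x | ξ) (y | η)
    · rw [Fintype.sum_sum_type]
      simp only [doubleTensor, zero_smul, Finset.sum_const_zero, zero_add, Sum.swap_inr]
      refine LinearMap.ext fun a => ?_
      have h := congrArg (fun D => D a) (lie_unitDer (K := K) i x y)
      simp only [Derivation.commutator_apply, derivation_sum_apply] at h
      rw [LinearMap.sum_apply]
      exact h
    · rw [Fintype.sum_sum_type]
      simp only [doubleTensor, zero_smul, Finset.sum_const_zero, add_zero, Sum.swap_inl]
      simp only [structConst_antisymm x, neg_smul, Finset.sum_neg_distrib, sum_structConst_mid]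
      refine LinearMap.ext fun a => ?_
      show matVar K i η.1 η.2 * unitDer K i x a - unitDer K i x (matVar K i η.1 η.2 * a) = _
      rw [Derivation.leibniz, unitDer_matVar, if_pos rfl]
      simp only [LinearMap.neg_apply, LinearMap.sub_apply, smul_eq_mul]
      split_ifs <;> simp [doubleOp] <;> ring
    · rw [Fintype.sum_sum_type]
      simp only [doubleTensor, zero_smul, Finset.sum_const_zero, add_zero, Sum.swap_inl]
      simp only [sum_structConst_mid]
      refine LinearMap.ext fun a => ?_
      show unitDer K i y (matVar K i ξ.1 ξ.2 * a) - matVar K i ξ.1 ξ.2 * unitDer K i y a = _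
      rw [Derivation.leibniz, unitDer_matVar, if_pos rfl]
      simp only [LinearMap.sub_apply, smul_eq_mul]
      split_ifs <;> simp [doubleOp] <;> ring
    · rw [Fintype.sum_sum_type]
      simp only [doubleTensor, zero_smul, Finset.sum_const_zero, add_zero]
      refine LinearMap.ext fun a => sub_eq_zero.2 ?_
      exact mul_left_comm _ _ _

variable {n I}

/-- The derivation by which a chord acts. -/
def chordDer (c : Chord n) : Derivation K (MatPoly K n I) (MatPoly K n I) :=
  ∑ e : I × I, (matVar K c.hi e.1 e.2 • unitDer K c.lo e + matVar K c.lo e.1 e.2 • unitDer K c.hi e)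

theorem chordOp_matWeight (c : Chord n) (a : MatPoly K n I) :
    (matWeight K n I).chordOp c a = chordDer K c a := by
  rw [WeightData.chordOp, LinearMap.sum_apply, Fintype.sum_sum_type, chordDer,
    derivation_sum_apply, ← Finset.sum_add_distrib]
  refine Finset.sum_congr rfl fun e _ => ?_
  have h1 := (matWeight K n I).comm _ _ c.lo_lt_hi.ne (.inl e) (.inr e)
  have h2 := congrArg (fun D : Module.End K (MatPoly K n I) => D a) h1.eq
  exact congrArg (· + _) h2

variable {K}

/-- The matrix on the strand `l` applied to a vector. -/
def matMul (l : Fin n) : (I → MatPoly K n I) →ₗ[K] (I → MatPoly K n I) where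
  toFun u p := ∑ q, matVar K l p q * u q
  map_add' u v := by
    funext p
    simp [mul_add, Finset.sum_add_distrib]
  map_smul' c u := by
    funext p
    simp [Finset.smul_sum]

theorem sum_smul_unitDer_vecVar (i j m : Fin n) (p : I) :
    ∑ e : I × I, matVar K j e.1 e.2 * unitDer K i e (vecVar K m p) =
      if m = i then matMul j (vecVar K m) p else 0 := by
  rw [Fintype.sum_prod_type]
  by_cases h : m = i
  · simp [unitDer_vecVar, h, matMul]
  · simp [unitDer_vecVar, h]

theorem sum_smul_unitDer_matVar (i j l : Fin n) (p q : I) :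
    ∑ e : I × I, matVar K j e.1 e.2 * unitDer K i e (matVar K l p q) =
      if l = i then ∑ r, matVar K j p r * matVar K i r q - ∑ r, matVar K i p r * matVar K j r q
      else 0 := by
  rw [Fintype.sum_prod_type]
  by_cases h : l = i
  · subst h
    simp only [unitDer_matVar, if_true, mul_sub, Finset.sum_sub_distrib]
    congr 1
    · simp
    · simp [mul_comm]
  · simp [unitDer_matVar, h]

theorem chordDer_apply (c : Chord n) (a : MatPoly K n I) : chordDer K c a =
    ∑ e : I × I, matVar K c.hi e.1 e.2 * unitDer K c.lo e a +
      ∑ e : I × I, matVar K c.lo e.1 e.2 * unitDer K c.hi e a := by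
  rw [chordDer, derivation_sum_apply, ← Finset.sum_add_distrib]
  rfl

theorem chordDer_vecVar (c : Chord n) (m : Fin n) :
    (fun p => chordDer K c (vecVar K m p)) =
      (if m = c.hi then matMul c.lo (vecVar (I := I) K m) else 0) +
      (if m = c.lo then matMul c.hi (vecVar (I := I) K m) else 0) := by
  funext p
  rw [chordDer_apply, sum_smul_unitDer_vecVar, sum_smul_unitDer_vecVar, add_comm, Pi.add_apply]
  congr 1 <;> split_ifs <;> rfl

theorem chordDer_matMul (c : Chord n) (l : Fin n) (u : I → MatPoly K n I) :
    (fun p => chordDer K c (matMul l u p)) =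
      matMul l (fun p => chordDer K c (u p)) +
      ((if l = c.lo then matMul c.hi (matMul c.lo u) - matMul c.lo (matMul c.hi u) else 0) +
      (if l = c.hi then matMul c.lo (matMul c.hi u) - matMul c.hi (matMul c.lo u) else 0)) := by
  have key : ∀ (i j : Fin n) (p : I), ∑ q, u q *
      (∑ r, matVar K j p r * matVar K i r q - ∑ r, matVar K i p r * matVar K j r q) =
      matMul j (matMul i u) p - matMul i (matMul j u) p := by
    intro i j p
    simp only [mul_sub, Finset.sum_sub_distrib, Finset.mul_sum, matMul, LinearMap.coe_mk,
      AddHom.coe_mk]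
    congr 1 <;>
    · rw [Finset.sum_comm]
      exact Finset.sum_congr rfl fun _ _ => Finset.sum_congr rfl fun _ _ => by ring
  funext p
  have h : chordDer K c (matMul l u p) = ∑ q, matVar K l p q * chordDer K c (u q) +
      ∑ q, u q * chordDer K c (matVar K l p q) := by
    show chordDer K c (∑ q, matVar K l p q * u q) = _
    rw [map_sum, ← Finset.sum_add_distrib]
    exact Finset.sum_congr rfl fun q _ => by rw [Derivation.leibniz]; rfl
  rw [h, Pi.add_apply]
  congr 1
  simp only [chordDer_apply c (matVar K l p _), sum_smul_unitDer_matVar, mul_add,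
    Finset.sum_add_distrib, Pi.add_apply]
  congr 1
  · split_ifs
    · exact key _ _ p
    · simp
  · split_ifs
    · exact key _ _ p
    · simp

end Matrices

/-! ### Sorted chord diagrams act independently -/

section Families

variable {n : ℕ}

/-- Some list contains a letter that is at least its own index. -/
def Improper (s : Fin n → List (Fin n)) : Prop := ∃ m, ∃ l ∈ s m, m ≤ l

/-- The total length of the lists, with weights that increase with the index. -/
def height (s : Fin n → List (Fin n)) : ℕ := ∑ m, m.val * (s m).length

/-- The families of lists that are negligible compared with a proper one of height `N`. -/
def negligible (N : ℕ) : Set (Fin n → List (Fin n)) := {s | Improper s ∨ N < height s}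

theorem height_update (s : Fin n → List (Fin n)) (m : Fin n) (w : List (Fin n))
    (h : w.length = (s m).length + 1) : height (Function.update s m w) = height s + m.val := by
  rw [height, height, ← Finset.sum_erase_add _ _ (Finset.mem_univ m),
    ← Finset.sum_erase_add (a := m) (s := Finset.univ) (f := fun m => m.val * (s m).length)
      (Finset.mem_univ m), Function.update_self, h, mul_add, mul_one, add_assoc]
  congr 1
  exact Finset.sum_congr rfl fun k hk => by rw [Function.update_of_ne (Finset.ne_of_mem_erase hk)]

theorem negligible_mono {N N' : ℕ} (h : N ≤ N') :
    (negligible N' : Set (Fin n → List (Fin n))) ⊆ negligible N := fun _ hs =>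
  hs.imp_right fun hs => h.trans_lt hs

theorem improper_update {s : Fin n → List (Fin n)} (m : Fin n) {w : List (Fin n)}
    (h : s m ⊆ w) (hs : Improper s) : Improper (Function.update s m w) := by
  obtain ⟨k, l, hl, hkl⟩ := hs
  refine ⟨k, l, ?_, hkl⟩
  by_cases hk : k = m
  · subst hk
    rw [Function.update_self]
    exact h hl
  · rwa [Function.update_of_ne hk]

end Families

theorem derivation_prod {ι R A : Type*} [CommRing R] [CommRing A] [Algebra R A] [DecidableEq ι]
    (D : Derivation R A A) (s : Finset ι) (f : ι → A) :
    D (∏ i ∈ s, f i) = ∑ i ∈ s, (∏ j ∈ s.erase i, f j) * D (f i) := by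
  induction s using Finset.induction_on with
  | empty => simp
  | insert a s ha ih =>
    rw [Finset.prod_insert ha, Derivation.leibniz, ih, Finset.sum_insert ha,
      Finset.erase_insert ha, add_comm, smul_eq_mul, smul_eq_mul, Finset.mul_sum]
    congr 1
    refine Finset.sum_congr rfl fun i hi => ?_
    have hai : a ≠ i := fun h => ha (h ▸ hi)
    rw [Finset.erase_insert_of_ne hai, Finset.prod_insert fun h => ha (Finset.mem_of_mem_erase h),
      mul_assoc]

section Independence

variable {K : Type*} [CommRing K] {n : ℕ} {I : Type} [Fintype I]

/-- The vector of the strand `m` multiplied by the matrices of the strands in a list. -/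
def wordVec (m : Fin n) (w : List (Fin n)) : I → MatPoly K n I :=
  w.foldr (fun l u => matMul l u) (vecVar K m)

/-- `w'` is one letter longer than `w`, and it contains all letters of `w` as well as both strands
of the chord `c`. -/
def Extends (c : Chord n) (w w' : List (Fin n)) : Prop :=
  w'.length = w.length + 1 ∧ w ⊆ w' ∧ c.lo ∈ w' ∧ c.hi ∈ w'

variable (K) in
/-- The product over the strands `m` of the entry `o m` of `wordVec m (s m)`. -/
def wordProd (o : Fin n → I) (s : Fin n → List (Fin n)) : MatPoly K n I :=
  ∏ m, wordVec m (s m) (o m)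

theorem wordProd_update (o : Fin n → I) (s : Fin n → List (Fin n)) (m : Fin n)
    (w : List (Fin n)) : wordProd K o (Function.update s m w) =
      (∏ k ∈ Finset.univ.erase m, wordVec k (s k) (o k)) * wordVec m w (o m) := by
  rw [wordProd, ← Finset.prod_erase_mul _ _ (Finset.mem_univ m), Function.update_self]
  congr 1
  exact Finset.prod_congr rfl fun k hk => by rw [Function.update_of_ne (Finset.ne_of_mem_erase hk)]

variable [DecidableEq I]

/-- A chord acts on `wordVec m w` by appending a letter if `m` is one of the strands of the chord,
up to words which contain both of these strands. -/
theorem chordDer_wordVec (c : Chord n) (m : Fin n) (w : List (Fin n)) :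
    (fun p => chordDer K c (wordVec (I := I) m w p)) -
      ((if m = c.hi then wordVec m (w ++ [c.lo]) else 0) +
        (if m = c.lo then wordVec m (w ++ [c.hi]) else 0)) ∈
      Submodule.span K (wordVec (K := K) (I := I) m '' {w' | Extends c w w'}) := by
  induction w with
  | nil =>
    have := chordDer_vecVar (K := K) (I := I) c m
    show (fun p => chordDer K c (vecVar K m p)) - ((if m = c.hi then matMul c.lo (vecVar K m) else 0) +
      (if m = c.lo then matMul c.hi (vecVar K m) else 0)) ∈ _
    rw [this, sub_self]
    exact Submodule.zero_mem _
  | cons l w ih =>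
    have e := chordDer_matMul (K := K) c l (wordVec (I := I) m w)
    have ih' := Submodule.mem_map_of_mem (f := matMul (K := K) (I := I) l) ih
    rw [Submodule.map_span] at ih'
    have hle : Submodule.span K ((matMul (K := K) (I := I) l) ''
        (wordVec (K := K) (I := I) m '' {w' | Extends c w w'})) ≤
        Submodule.span K (wordVec (K := K) (I := I) m '' {w' | Extends c (l :: w) w'}) := by
      refine Submodule.span_mono ?_
      rintro _ ⟨_, ⟨w', ⟨h1, h2, h3, h4⟩, rfl⟩, rfl⟩
      exact ⟨l :: w', ⟨by simp [h1], List.cons_subset_cons l h2, List.mem_cons_of_mem _ h3,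
        List.mem_cons_of_mem _ h4⟩, rfl⟩
    have hnew : ∀ a b : Fin n, (a = c.lo ∧ b = c.hi ∨ a = c.hi ∧ b = c.lo) → (l = a ∨ l = b) →
        matMul a (matMul b (wordVec m w)) ∈
        Submodule.span K (wordVec (K := K) (I := I) m '' {w' | Extends c (l :: w) w'}) := by
      intro a b hab hl
      refine Submodule.subset_span ⟨a :: b :: w, ⟨rfl, ?_, ?_, ?_⟩, rfl⟩
      · intro z hz
        rcases List.mem_cons.1 hz with rfl | hz
        · rcases hl with rfl | rfl <;> simp
        · simp [hz]
      · rcases hab with ⟨rfl, rfl⟩ | ⟨rfl, rfl⟩ <;> simp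
      · rcases hab with ⟨rfl, rfl⟩ | ⟨rfl, rfl⟩ <;> simp
    have e' : (fun p => chordDer K c (wordVec (I := I) m (l :: w) p)) -
        ((if m = c.hi then wordVec m (l :: w ++ [c.lo]) else 0) +
        (if m = c.lo then wordVec m (l :: w ++ [c.hi]) else 0)) =
        matMul l ((fun p => chordDer K c (wordVec (I := I) m w p)) -
          ((if m = c.hi then wordVec m (w ++ [c.lo]) else 0) +
          (if m = c.lo then wordVec m (w ++ [c.hi]) else 0))) +
        ((if l = c.lo then matMul c.hi (matMul c.lo (wordVec m w)) -
            matMul c.lo (matMul c.hi (wordVec m w)) else 0) +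
          (if l = c.hi then matMul c.lo (matMul c.hi (wordVec m w)) -
            matMul c.hi (matMul c.lo (wordVec m w)) else 0)) := by
      rw [map_sub, map_add, apply_ite (matMul l), apply_ite (matMul l), map_zero]
      refine (congrArg (· - _) e).trans ?_
      rw [add_sub_right_comm]
      rfl
    rw [e']
    refine Submodule.add_mem _ (hle ih') (Submodule.add_mem _ ?_ ?_)
    · split_ifs with h
      · exact Submodule.sub_mem _ (hnew _ _ (Or.inr ⟨rfl, rfl⟩) (Or.inr h))
          (hnew _ _ (Or.inl ⟨rfl, rfl⟩) (Or.inl h))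
      · exact Submodule.zero_mem _
    · split_ifs with h
      · exact Submodule.sub_mem _ (hnew _ _ (Or.inl ⟨rfl, rfl⟩) (Or.inr h))
          (hnew _ _ (Or.inr ⟨rfl, rfl⟩) (Or.inl h))
      · exact Submodule.zero_mem _

/-- A chord acts on `wordProd o s` by appending one of its strands to the list of the other one, up
to terms in which one list is extended by a letter and contains both strands of the chord. -/
theorem chordDer_wordProd (o : Fin n → I) (c : Chord n) (s : Fin n → List (Fin n)) :
    chordDer K c (wordProd K o s) -
      (wordProd K o (Function.update s c.hi (s c.hi ++ [c.lo])) +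
        wordProd K o (Function.update s c.lo (s c.lo ++ [c.hi]))) ∈
      Submodule.span K (wordProd K o ''
        {s' | ∃ m w', Extends c (s m) w' ∧ s' = Function.update s m w'}) := by
  let T : Fin n → (I → MatPoly K n I) →ₗ[K] MatPoly K n I := fun m =>
    LinearMap.mulLeft K (∏ k ∈ Finset.univ.erase m, wordVec k (s k) (o k)) ∘ₗ
      LinearMap.proj (o m)
  have hT : ∀ m w, T m (wordVec m w) = wordProd K o (Function.update s m w) := fun m w =>
    (wordProd_update o s m w).symm
  have key : ∑ m, T m ((fun p => chordDer K c (wordVec (I := I) m (s m) p)) -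
      ((if m = c.hi then wordVec m (s m ++ [c.lo]) else 0) +
        (if m = c.lo then wordVec m (s m ++ [c.hi]) else 0))) ∈
      Submodule.span K (wordProd K o ''
        {s' | ∃ m w', Extends c (s m) w' ∧ s' = Function.update s m w'}) := by
    refine Submodule.sum_mem _ fun m _ => ?_
    have := Submodule.mem_map_of_mem (f := T m) (chordDer_wordVec c m (s m))
    rw [Submodule.map_span] at this
    refine Submodule.span_mono ?_ this
    rintro _ ⟨_, ⟨w', hw', rfl⟩, rfl⟩
    exact ⟨_, ⟨m, w', hw', rfl⟩, (hT m w').symm⟩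
  convert key using 1
  simp only [map_sub, map_add, Finset.sum_sub_distrib, Finset.sum_add_distrib]
  congr 1
  · rw [wordProd, derivation_prod]
    rfl
  · congr 1
    · rw [Finset.sum_eq_single c.hi, if_pos rfl, hT]
      · intro m _ hm
        rw [if_neg hm, map_zero]
      · exact fun h => absurd (Finset.mem_univ _) h
    · rw [Finset.sum_eq_single c.lo, if_pos rfl, hT]
      · intro m _ hm
        rw [if_neg hm, map_zero]
      · exact fun h => absurd (Finset.mem_univ _) h

/-- Up to negligible terms, a chord acts by appending its first strand to the list of its last
strand. -/
theorem chordDer_wordProd_sub_mem (o : Fin n → I) (c : Chord n) (s : Fin n → List (Fin n)) :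
    chordDer K c (wordProd K o s) - wordProd K o (Function.update s c.hi (s c.hi ++ [c.lo])) ∈
      Submodule.span K (wordProd K o '' negligible (height s + c.hi.val)) := by
  rw [← sub_add_cancel (chordDer K c (wordProd K o s) - _)
    (wordProd K o (Function.update s c.lo (s c.lo ++ [c.hi]))), sub_sub]
  refine Submodule.add_mem _ (Submodule.span_mono (Set.image_mono ?_) (chordDer_wordProd o c s))
    (Submodule.subset_span ⟨_, Or.inl ⟨c.lo, c.hi, by simp, c.lo_lt_hi.le⟩, rfl⟩)
  rintro _ ⟨m, w', ⟨h1, h2, h3, h4⟩, rfl⟩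
  -- the list of `m` now contains `c.hi`, which makes it improper unless `m` lies beyond `c.hi`
  rcases le_or_gt m c.hi with h | h
  · exact Or.inl ⟨m, c.hi, by rwa [Function.update_self], h⟩
  · refine Or.inr ?_
    rw [height_update s m w' h1]
    exact Nat.add_lt_add_left h _

theorem chordDer_mem_of_negligible (o : Fin n → I) (c : Chord n) {N : ℕ} {a : MatPoly K n I}
    (ha : a ∈ Submodule.span K (wordProd K o '' negligible N)) :
    chordDer K c a ∈ Submodule.span K (wordProd K o '' negligible (N + c.hi.val)) := by
  suffices h : ∀ s ∈ negligible N, chordDer K c (wordProd K o s) ∈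
      Submodule.span K (wordProd K o '' negligible (N + c.hi.val)) by
    have := Submodule.mem_map_of_mem
      (f := (chordDer K c : Derivation K (MatPoly K n I) (MatPoly K n I)).toLinearMap) ha
    rw [Submodule.map_span] at this
    refine Submodule.span_le.2 ?_ this
    rintro _ ⟨_, ⟨s, hs, rfl⟩, rfl⟩
    exact h s hs
  rintro s (hs | hs)
  · rw [← sub_add_cancel (chordDer K c (wordProd K o s))
      (wordProd K o (Function.update s c.hi (s c.hi ++ [c.lo])) +
        wordProd K o (Function.update s c.lo (s c.lo ++ [c.hi])))]
    refine Submodule.add_mem _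
      (Submodule.span_mono (Set.image_mono ?_) (chordDer_wordProd o c s))
      (Submodule.add_mem _ (Submodule.subset_span ⟨_, Or.inl ?_, rfl⟩)
        (Submodule.subset_span ⟨_, Or.inl ?_, rfl⟩))
    · rintro _ ⟨m, w', ⟨-, h2, -⟩, rfl⟩
      exact Or.inl (improper_update m h2 hs)
    · exact improper_update _ (List.subset_append_left _ _) hs
    · exact improper_update _ (List.subset_append_left _ _) hs
  · rw [← sub_add_cancel (chordDer K c (wordProd K o s))
      (wordProd K o (Function.update s c.hi (s c.hi ++ [c.lo])))]
    refine Submodule.add_mem _ (Submodule.span_mono (Set.image_mono (negligible_mono ?_))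
      (chordDer_wordProd_sub_mem o c s)) (Submodule.subset_span ⟨_, Or.inr ?_, rfl⟩)
    · exact Nat.add_le_add_right hs.le _
    · rw [height_update _ _ _ (by simp)]
      exact Nat.add_lt_add_right hs _

/-- Applied to the product of one vector entry for each strand, a chord diagram gives the product
belonging to its partners, up to negligible terms. -/
theorem prod_chordOp_sub_mem (o : Fin n → I) (w : PbDiagram n) :
    (w.map (matWeight K n I).chordOp).prod (wordProd K o fun _ => []) -
      wordProd K o (partners w) ∈
      Submodule.span K (wordProd K o '' negligible (height (partners w))) := by
  induction w with
  | nil =>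
    rw [List.map_nil, List.prod_nil, Module.End.one_apply, partners, sub_self]
    exact Submodule.zero_mem _
  | cons c w ih =>
    rw [List.map_cons, List.prod_cons, Module.End.mul_apply, chordOp_matWeight]
    have hh : height (partners (c :: w)) = height (partners w) + c.hi.val :=
      height_update _ _ _ (by simp)
    have h1 := chordDer_mem_of_negligible o c ih
    have h2 := chordDer_wordProd_sub_mem (K := K) o c (partners w)
    rw [hh]
    have := Submodule.add_mem _ h1 h2
    rw [map_sub, sub_add_sub_cancel] at this
    exact this

end Independence

/-! ### Evaluation at a point -/

section Evaluation

variable {K : Type*} [CommRing K] {n d : ℕ} (s₀ : Fin n → List (Fin n))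

variable (K d) in
/-- The evaluation that singles out a family of lists `s₀` of length at most `d`. The matrices
have one block for each strand; in the block of `m`, the matrix of the strand `i` has an entry `1`
just above the diagonal for each occurrence of `i` in `s₀ m`, and the vectors have an entry `1`
at the end of that list. The vector entries beyond this end do not matter. -/
def evalAt : MatPoly K n (Fin n × Fin (d + 1)) →ₐ[K] K :=
  MvPolynomial.aeval fun
    | .inl (i, p, q) =>
      if p.1 = q.1 ∧ q.2.val = p.2.val + 1 ∧ (s₀ p.1)[p.2.val]? = some i then 1 else 0
    | .inr (_, p) => if (s₀ p.1).drop p.2.val = [] then 1 else 0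

/-- At this point, the product of matrices given by `w` moves along the block of `p` exactly if the
letters of `w` are those of the list of the block, and it ends at the vector entry `1` exactly if
that list is used up. -/
theorem evalAt_wordVec (hd : ∀ m, (s₀ m).length ≤ d) (m : Fin n) (w : List (Fin n))
    (p : Fin n × Fin (d + 1)) :
    evalAt K d s₀ (wordVec m w p) = if w = (s₀ p.1).drop p.2.val then 1 else 0 := by
  induction w generalizing p with
  | nil =>
    show evalAt K d s₀ (vecVar K m p) = _
    rw [evalAt, vecVar, MvPolynomial.aeval_X]
    simp only [eq_comm]
  | cons i w ih =>
    show evalAt K d s₀ (∑ q, matVar K i p q * wordVec m w q) = _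
    obtain ⟨k, a⟩ := p
    simp only [map_sum, map_mul, ih]
    simp only [evalAt, matVar, MvPolynomial.aeval_X]
    by_cases h : (s₀ k)[a.val]? = some i
    · obtain ⟨hlt, hi⟩ := List.getElem?_eq_some_iff.1 h
      have ha : a.val + 1 < d + 1 := by have := hd k; omega
      rw [Finset.sum_eq_single (k, ⟨a.val + 1, ha⟩)]
      · rw [List.drop_eq_getElem_cons hlt, hi]
        simp [h]
      · rintro ⟨k', a'⟩ - hne
        rw [if_neg, zero_mul]
        rintro ⟨rfl, h2, -⟩
        exact hne (Prod.ext rfl (Fin.ext h2))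
      · exact fun h => absurd (Finset.mem_univ _) h
    · rw [Finset.sum_eq_zero, if_neg]
      · intro e
        have := congrArg (fun l => l[0]?) e
        simp only [List.getElem?_drop, add_zero, List.getElem?_cons_zero] at this
        exact h this.symm
      · intro q _
        rw [if_neg (fun hq => h hq.2.2), zero_mul]

theorem evalAt_wordProd (hd : ∀ m, (s₀ m).length ≤ d) (s : Fin n → List (Fin n)) :
    evalAt K d s₀ (wordProd K (fun m => (m, 0)) s) = if s = s₀ then 1 else 0 := by
  simp only [wordProd, map_prod, evalAt_wordVec s₀ hd]
  split_ifs with h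
  · subst h
    simp
  · obtain ⟨m, hm⟩ := Function.ne_iff.1 h
    exact Finset.prod_eq_zero (Finset.mem_univ m) (if_neg hm)

/-- The functional on `A^{sl}` that detects the sorted chord diagrams with partners `s₀`. -/
theorem exists_functional (w₀ : PbDiagram n) : ∃ F : Asl K n →ₗ[K] K, ∀ w : PbDiagram n,
    height (partners w₀) ≤ height (partners w) →
      F (Asl.mk K (PbDiagram.toSl w)) = if partners w = partners w₀ then 1 else 0 := by
  set s₀ := partners w₀ with hs₀
  let d := ∑ m, (s₀ m).length
  have hd : ∀ m, (s₀ m).length ≤ d := fun m =>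
    Finset.single_le_sum (f := fun m => (s₀ m).length) (fun _ _ => Nat.zero_le _)
      (Finset.mem_univ m)
  let o : Fin n → Fin n × Fin (d + 1) := fun m => (m, 0)
  refine ⟨(evalAt K d s₀).toLinearMap ∘ₗ LinearMap.applyₗ (wordProd K o fun _ => []) ∘ₗ
    (matWeight K n (Fin n × Fin (d + 1))).weightHom, fun w hw => ?_⟩
  have h1 : ∀ a ∈ Submodule.span K (wordProd K o '' negligible (height (partners w))),
      evalAt K d s₀ a = 0 := by
    intro a ha
    have hle : Submodule.span K (wordProd K o '' negligible (height (partners w))) ≤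
        LinearMap.ker (evalAt K d s₀).toLinearMap := by
      rw [Submodule.span_le]
      rintro _ ⟨s, hs, rfl⟩
      refine (evalAt_wordProd s₀ hd s).trans (if_neg ?_)
      rintro rfl
      rcases hs with ⟨m, l, hl, hml⟩ | hs
      · exact absurd (partners_lt w₀ m l (hs₀ ▸ hl)) (not_lt.2 hml)
      · exact absurd hs (not_lt.2 hw)
    exact hle ha
  have h2 := h1 _ (prod_chordOp_sub_mem o w)
  rw [map_sub, sub_eq_zero, evalAt_wordProd s₀ hd] at h2
  simp only [LinearMap.comp_apply, WeightData.weightHom_mk, WeightData.weight_toSl]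
  exact h2

end Evaluation

/-- In a linear combination of sorted chord diagrams, a diagram of minimal height is detected by a
functional on `A^{sl}` which vanishes on all the others. -/
theorem apbHom_injective (K : Type*) [CommRing K] (n : ℕ) :
    Function.Injective (apbHom K n) := by
  rw [← LinearMap.ker_eq_bot, LinearMap.ker_eq_bot']
  intro a ha
  obtain ⟨l, hl, rfl⟩ := (Finsupp.mem_span_image_iff_linearCombination K).1 (mem_span_sorted a)
  by_contra hne
  have hl0 : l.support.Nonempty := by
    rw [Finsupp.support_nonempty_iff]
    rintro rfl
    exact hne (map_zero _)
  obtain ⟨w₀, hw₀, hmin⟩ := l.support.exists_min_image (fun w => height (partners w)) hl0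
  obtain ⟨F, hF⟩ := exists_functional (K := K) w₀
  have hsort : ∀ w ∈ l.support, Sorted w := fun w hw => (Finsupp.mem_supported K l).1 hl hw
  have h := congrArg F ha
  rw [Finsupp.linearCombination_apply, Finsupp.sum, map_sum, map_sum, map_zero,
    Finset.sum_eq_single w₀] at h
  · rw [map_smul, map_smul, apbHom_mk, hF w₀ le_rfl, if_pos rfl, smul_eq_mul, mul_one] at h
    exact Finsupp.mem_support_iff.1 hw₀ h
  · intro w hw hww
    rw [map_smul, map_smul, apbHom_mk, hF w (hmin w hw), if_neg, smul_zero]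
    exact fun e => hww (partners_injOn (hsort w hw) (hsort w₀ hw₀) e)
  · exact fun h => absurd hw₀ h

end

end ChordDiagrams

theorem mainTheorem6 (K : Type*) [CommRing K] (n : ℕ) :
    ∃ φ : ChordDiagrams.Apb K n →ₗ[K] ChordDiagrams.Asl K n,
      (∀ w : ChordDiagrams.PbDiagram n,
        φ (ChordDiagrams.Apb.mk K w) = ChordDiagrams.Asl.mk K (ChordDiagrams.PbDiagram.toSl w)) ∧
      Function.Injective φ :=
  ⟨ChordDiagrams.apbHom K n, ChordDiagrams.apbHom_mk, ChordDiagrams.apbHom_injective K n⟩
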